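/- There exist universal constants $c_0,c_1,c_2>0$ such that the following holds. Let $n_1,n_2\ge 1$ and let $M\in\mathbb{R}^{n_1\times n_2}$ be a matrix of rank $r$ with rank-$r$ singular value decomposition $M=U\Sigma V^{\top}$ ($U\in\mathbb{R}^{n_1\times r}$ and $V\in\mathbb{R}^{n_2\times r}$ with orthonormal columns, $\Sigma$ diagonal with positive diagonal entries). Suppose that $M$ satisfies the standard incoherence condition with parameter $\mu_0$, that is, $$\max_{1\le i\le n_1}\|U^{\top}e_i\|_2\le\sqrt{\frac{\mu_0 r}{n_1}},\qquad \max_{1\le j\le n_2}\|V^{\top}e_j\|_2\le\sqrt{\frac{\mu_0 r}{n_2}},$$ where $e_i$ denotes the $i$-th standard basis vector of the appropriate dimension (no bound on the entries of $UV^{\top}$, i.e. no joint incoherence, is assumed). Let $\Omega$ be a random set of indices that contains each $(i,j)\in\{1,\dots,n_1\}\times\{1,\dots,n_2\}$ with probability $p\in[0,1]$, independently of all others. If $$p\ge c_0\,\frac{\mu_0 r\log^2(n_1+n_2)}{\min\{n_1,n_2\}},$$ then, with probability at least $1-c_1(n_1+n_2)^{-c_2}$, $M$ is the unique optimal solution of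 the nuclear norm minimization problem $$\min_{X\in\mathbb{R}^{n_1\times n_2}}\ \|X\|_*\quad\text{subject to}\quad X_{ij}=M_{ij}\ \text{ for all }(i,j)\in\Omega,$$ where $\|X\|_*$ denotes the nuclear norm, the sum of the singular values of $X$. -/

import Mathlib

open scoped Matrix
open MeasureTheory ProbabilityTheory

namespace MatrixCompletion

/-- The nuclear norm of a real matrix: the sum of its singular values
(with multiplicity; only finitely many terms of the sequence are nonzero). -/
noncomputable def nuclearNorm {n₁ n₂ : ℕ} (X : Matrix (Fin n₁) (Fin n₂) ℝ) : ℝ :=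
  (Matrix.toEuclideanLin X).singularValues.sum fun _ s => s

/-- `M = U Σ Vᵀ` is a rank-`r` (compact) singular value decomposition: `U` and `V` have `r`
orthonormal columns and `Σ = diag σ` has positive diagonal entries. -/
structure IsCompactSVD {n₁ n₂ r : ℕ} (M : Matrix (Fin n₁) (Fin n₂) ℝ)
    (U : Matrix (Fin n₁) (Fin r) ℝ) (σ : Fin r → ℝ) (V : Matrix (Fin n₂) (Fin r) ℝ) : Prop where
  left_orthonormal : Uᵀ * U = 1
  right_orthonormal : Vᵀ * V = 1
  pos : ∀ k, 0 < σ k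
  eq : M = U * Matrix.diagonal σ * Vᵀ

/-- The rank-`r` matrix `M` satisfies the standard incoherence condition with parameter `μ₀`:
for a rank-`r` SVD `M = U Σ Vᵀ`, `‖Uᵀ eᵢ‖₂ ≤ √(μ₀ r / n₁)` for all `i` and
`‖Vᵀ eⱼ‖₂ ≤ √(μ₀ r / n₂)` for all `j`. (The norms are the same for every rank-`r` SVD of `M`,
being determined by the column and row spaces of `M`.) -/
def StandardIncoherence {n₁ n₂ : ℕ} (M : Matrix (Fin n₁) (Fin n₂) ℝ) (r : ℕ) (μ₀ : ℝ) : Prop :=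
  ∃ (U : Matrix (Fin n₁) (Fin r) ℝ) (σ : Fin r → ℝ) (V : Matrix (Fin n₂) (Fin r) ℝ),
    IsCompactSVD M U σ V ∧
    (∀ i, ‖WithLp.toLp 2 (Uᵀ *ᵥ Pi.single i 1)‖ ≤ √(μ₀ * r / n₁)) ∧
    (∀ j, ‖WithLp.toLp 2 (Vᵀ *ᵥ Pi.single j 1)‖ ≤ √(μ₀ * r / n₂))

/-- Bernoulli sampling: under `P`, each entry `(i, j)` belongs to the random set `Ω` of observed
indices with probability `p`, independently of all the others. -/
structure IsBernoulliSampling {S : Type*} [MeasurableSpace S] (P : Measure S) {n₁ n₂ : ℕ}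
    (Ω : S → Set (Fin n₁ × Fin n₂)) (p : ℝ) : Prop where
  measurable : ∀ ij, MeasurableSet {s | ij ∈ Ω s}
  indep : iIndepSet (fun ij => {s | ij ∈ Ω s}) P
  prob : ∀ ij, P.real {s | ij ∈ Ω s} = p

/-- `X` agrees with `M` at all observed entries. -/
def IsFeasible {n₁ n₂ : ℕ} (M : Matrix (Fin n₁) (Fin n₂) ℝ) (Ω : Set (Fin n₁ × Fin n₂))
    (X : Matrix (Fin n₁) (Fin n₂) ℝ) : Prop :=
  ∀ ij ∈ Ω, X ij.1 ij.2 = M ij.1 ij.2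

/-- `Y` is the unique optimal solution of: minimize `‖X‖_*` subject to `X i j = M i j` for all
observed `(i, j) ∈ Ω`. -/
def IsUniqueOptimal {n₁ n₂ : ℕ} (M : Matrix (Fin n₁) (Fin n₂) ℝ) (Ω : Set (Fin n₁ × Fin n₂))
    (Y : Matrix (Fin n₁) (Fin n₂) ℝ) : Prop :=
  IsFeasible M Ω Y ∧ ∀ X, IsFeasible M Ω X → X ≠ Y → nuclearNorm Y < nuclearNorm X

end MatrixCompletion

namespace MatrixCompletion

/-! ### Perturbation of trace exponentials -/

/-! The argument is convex duality plus the golfing scheme. Write P = UUᵀ, Q = VVᵀ, let T be the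
projection onto the tangent space at `M`, N the complementary normal projection, and ν =
μ₀r/min(n₁,n₂), which bounds every diagonal entry of P and Q. For a feasible `X = M + H`, duality
between nuclear and spectral norm gives ‖X‖_* ≥ ‖M‖_* + ⟨UVᵀ, TH⟩ + ‖NH‖_*. A matrix Y supported on
the samples is orthogonal to H. If TY is very close to UVᵀ and NY has spectral norm at most 1/4, the
middle term costs less than ‖NH‖_*, provided TH is controlled by NH, and that holds when sampling is
well conditioned on the tangent space (`isUniqueOptimal_of_certificate`).

The certificate is built in N ≈ log(n₁+n₂) rounds, the sample being a union of N independent samples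
of density q ≥ p/N. Each round adds q⁻¹ times the sampled current residual Z and replaces Z by its
tangential error. The invariant `IsSpread` bounds the entries of Z by sν and its squared row and
column norms by s²ν, and s halves per round (`bernoulliProb_golfing_step`). Row and column norms are
what make joint incoherence unnecessary: the spectral error of a sampled Z is governed by them and
by the largest entry, and for UVᵀ they follow, as does the entry bound ν, from the incoherence of U
and V alone (`isSpread_mul_transpose`). Rounds of density about ν log(n₁+n₂), repeated about
log(n₁+n₂) times, account for the squared logarithm.

All concentration bounds come from one matrix Bernstein inequality. With m(θ) = E tr exp(θ ∑ (δ_k -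
p) A_k), a discrete integration by parts in each δ_k and the trace perturbation bound
`trace_mul_exp_sub_exp_le` give m' ≤ 4pVθ m; integrating bounds m, and Markov's inequality finishes.
Neither Golden–Thompson nor Lieb concavity enters. -/

lemma abs_exp_sub_exp_le (x y : ℝ) :
    |Real.exp y - Real.exp x| ≤ |y - x| * (Real.exp x + Real.exp y) := by
  have key : ∀ a b : ℝ, a ≤ b → Real.exp b - Real.exp a ≤ (b - a) * Real.exp b := by
    intro a b _
    have h := Real.add_one_le_exp (a - b)
    have h2 : Real.exp a = Real.exp b * Real.exp (a - b) := by rw [← Real.exp_add]; ring_nf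
    have := Real.exp_pos b
    nlinarith
  rcases le_total x y with h | h
  · rw [abs_of_nonneg (sub_nonneg.2 (Real.exp_le_exp.2 h)), abs_of_nonneg (sub_nonneg.2 h)]
    have := key x y h
    nlinarith [Real.exp_pos x]
  · rw [abs_sub_comm, abs_of_nonneg (sub_nonneg.2 (Real.exp_le_exp.2 h)), abs_sub_comm y x,
      abs_of_nonneg (sub_nonneg.2 h)]
    have := key y x h
    nlinarith [Real.exp_pos y]

section Core

variable {E : Type*} [NormedAddCommGroup E] [InnerProductSpace ℝ E]
  {ι ι' : Type*} [Fintype ι] [Fintype ι']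

lemma sum_inner_mul_inner_basis (u : OrthonormalBasis ι ℝ E) (a b : E) :
    ∑ i, inner ℝ (u i) a * inner ℝ (u i) b = inner ℝ a b := by
  rw [← u.sum_inner_mul_inner a b]
  exact Finset.sum_congr rfl fun i _ => by rw [real_inner_comm]

lemma sum_sq_inner_basis (u : OrthonormalBasis ι ℝ E) (a : E) :
    ∑ i, inner ℝ (u i) a ^ 2 = ‖a‖ ^ 2 := by
  rw [← real_inner_self_eq_norm_sq, ← sum_inner_mul_inner_basis u]
  simp [sq]

/-- If `Y = X + A` with `‖A‖ ≤ 1/2`, then `tr A (e^Y - e^X) ≤ 4 tr A² e^X`. -/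
lemma trace_mul_exp_sub_exp_le (u : OrthonormalBasis ι ℝ E) (v : OrthonormalBasis ι' ℝ E)
    {X Y A : E →ₗ[ℝ] E} (hX : X.IsSymmetric) (hA : A.IsSymmetric) (hYX : Y = X + A)
    {x : ι → ℝ} {y : ι' → ℝ} (hx : ∀ i, X (u i) = x i • u i) (hy : ∀ j, Y (v j) = y j • v j)
    (hn : ∀ z, ‖A z‖ ≤ 1 / 2 * ‖z‖) :
    ∑ j, Real.exp (y j) * inner ℝ (v j) (A (v j)) - ∑ i, Real.exp (x i) * inner ℝ (u i) (A (u i))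
      ≤ 4 * ∑ i, Real.exp (x i) * ‖A (u i)‖ ^ 2 := by
  -- In the two eigenbases A = Y - X has mixed coefficients (y_j - x_i) c_ij. The left side becomes
  -- ∑ c_ij² (y_j - x_i)(e^{y_j} - e^{x_i}), which the scalar inequality bounds by QX + QY, that is,
  -- tr A²e^X + tr A²e^Y.
  set c : ι → ι' → ℝ := fun i j => inner ℝ (u i) (v j) with hc
  have ha : ∀ i j, inner ℝ (u i) (A (v j)) = (y j - x i) * c i j := by
    intro i j
    have h1 : A (v j) = Y (v j) - X (v j) := by rw [hYX]; simp
    rw [h1, inner_sub_right, hy, ← hX, hx, inner_smul_right, real_inner_smul_left, sub_mul]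
  have ha' : ∀ i j, inner ℝ (v j) (A (u i)) = (y j - x i) * c i j := by
    intro i j
    rw [← hA, real_inner_comm, ha]
  have hc' : ∀ i j, inner ℝ (v j) (u i) = c i j := fun i j => real_inner_comm _ _
  have hAv : ∀ j, ∑ i, ((y j - x i) * c i j) ^ 2 = ‖A (v j)‖ ^ 2 := by
    intro j; rw [← sum_sq_inner_basis u]; simp only [ha]
  have hAu : ∀ i, ∑ j, ((y j - x i) * c i j) ^ 2 = ‖A (u i)‖ ^ 2 := by
    intro i; rw [← sum_sq_inner_basis v]; simp only [ha']
  set QX := ∑ i, Real.exp (x i) * ‖A (u i)‖ ^ 2 with hQX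
  set QY := ∑ j, Real.exp (y j) * ‖A (v j)‖ ^ 2 with hQY
  have hQX' : QX = ∑ i, ∑ j, ((y j - x i) * c i j) ^ 2 * Real.exp (x i) := by
    rw [hQX]; refine Finset.sum_congr rfl fun i _ => ?_
    rw [← hAu, ← Finset.sum_mul, mul_comm]
  have hQY' : QY = ∑ i, ∑ j, ((y j - x i) * c i j) ^ 2 * Real.exp (y j) := by
    rw [hQY, Finset.sum_comm]; refine Finset.sum_congr rfl fun j _ => ?_
    rw [← hAv, ← Finset.sum_mul, mul_comm]
  have h1 : ∑ j, Real.exp (y j) * inner ℝ (v j) (A (v j))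
      - ∑ i, Real.exp (x i) * inner ℝ (u i) (A (u i)) ≤ QX + QY := by
    have e1 : ∑ j, Real.exp (y j) * inner ℝ (v j) (A (v j))
        = ∑ i, ∑ j, Real.exp (y j) * (c i j * ((y j - x i) * c i j)) := by
      rw [Finset.sum_comm]; refine Finset.sum_congr rfl fun j _ => ?_
      rw [← sum_inner_mul_inner_basis u, Finset.mul_sum]; simp only [ha, hc]
    have e2 : ∑ i, Real.exp (x i) * inner ℝ (u i) (A (u i))
        = ∑ i, ∑ j, Real.exp (x i) * (c i j * ((y j - x i) * c i j)) := by
      refine Finset.sum_congr rfl fun i _ => ?_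
      rw [← sum_inner_mul_inner_basis v, Finset.mul_sum]; simp only [ha', hc']
    rw [e1, e2, hQX', hQY', ← Finset.sum_sub_distrib, ← Finset.sum_add_distrib]
    refine Finset.sum_le_sum fun i _ => ?_
    rw [← Finset.sum_sub_distrib, ← Finset.sum_add_distrib]
    refine Finset.sum_le_sum fun j _ => ?_
    have h := abs_exp_sub_exp_le (x i) (y j)
    have h2 : (y j - x i) * (Real.exp (y j) - Real.exp (x i))
        ≤ (y j - x i) ^ 2 * (Real.exp (x i) + Real.exp (y j)) := by
      refine (le_abs_self _).trans ?_
      rw [abs_mul, ← sq_abs (y j - x i), sq, mul_assoc]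
      exact mul_le_mul_of_nonneg_left h (abs_nonneg _)
    nlinarith [mul_le_mul_of_nonneg_left h2 (sq_nonneg (c i j))]
  have hA2 : ∀ z, ‖A (A z)‖ ^ 2 ≤ 1 / 4 * ‖A z‖ ^ 2 := by
    intro z
    nlinarith [hn (A z), norm_nonneg (A (A z)), norm_nonneg (A z)]
  -- The same expansion applied to A² in place of A, followed by AM-GM and ‖A‖ ≤ 1/2. It yields QY ≤
  -- 3 QX, hence the constant 4.
  have h2 : QY - QX ≤ 1 / 2 * (QX + QY) := by
    set b : ι → ι' → ℝ := fun i j => inner ℝ (u i) (A (A (v j))) with hb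
    have hb' : ∀ i j, inner ℝ (v j) (A (A (u i))) = b i j := by
      intro i j; rw [← hA, ← hA, real_inner_comm]
    have e1 : QY = ∑ i, ∑ j, Real.exp (y j) * (c i j * b i j) := by
      rw [hQY, Finset.sum_comm]; refine Finset.sum_congr rfl fun j _ => ?_
      rw [← real_inner_self_eq_norm_sq, hA, ← sum_inner_mul_inner_basis u, Finset.mul_sum]
    have e2 : QX = ∑ i, ∑ j, Real.exp (x i) * (c i j * b i j) := by
      rw [hQX]; refine Finset.sum_congr rfl fun i _ => ?_
      rw [← real_inner_self_eq_norm_sq, hA, ← sum_inner_mul_inner_basis v, Finset.mul_sum]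
      simp only [hb', hc']
    have e3 : QY - QX ≤ ∑ i, ∑ j, ((b i j) ^ 2 + 1 / 4 * ((y j - x i) * c i j) ^ 2) *
        (Real.exp (x i) + Real.exp (y j)) := by
      rw [e1, e2, ← Finset.sum_sub_distrib]
      refine Finset.sum_le_sum fun i _ => ?_
      rw [← Finset.sum_sub_distrib]
      refine Finset.sum_le_sum fun j _ => ?_
      have h := abs_exp_sub_exp_le (x i) (y j)
      calc _ = (c i j * b i j) * (Real.exp (y j) - Real.exp (x i)) := by ring
        _ ≤ |c i j * b i j| * |Real.exp (y j) - Real.exp (x i)| := by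
          rw [← abs_mul]; exact le_abs_self _
        _ ≤ |c i j * b i j| * (|y j - x i| * (Real.exp (x i) + Real.exp (y j))) :=
          mul_le_mul_of_nonneg_left h (abs_nonneg _)
        _ = (|b i j| * |(y j - x i) * c i j|) * (Real.exp (x i) + Real.exp (y j)) := by
          rw [abs_mul, abs_mul]; ring
        _ ≤ _ := by
          refine mul_le_mul_of_nonneg_right ?_ (by positivity)
          rw [← sq_abs (b i j), ← sq_abs ((y j - x i) * c i j)]
          nlinarith [sq_nonneg (|b i j| - 1 / 2 * |(y j - x i) * c i j|)]
    have e4 : ∑ i, ∑ j, (b i j) ^ 2 * Real.exp (x i) ≤ 1 / 4 * QX := by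
      rw [hQX, Finset.mul_sum]
      refine Finset.sum_le_sum fun i _ => ?_
      rw [← Finset.sum_mul]
      have : ∑ j, b i j ^ 2 = ‖A (A (u i))‖ ^ 2 := by
        rw [← sum_sq_inner_basis v]; simp only [hb']
      rw [this]; nlinarith [hA2 (u i), Real.exp_pos (x i)]
    have e5 : ∑ i, ∑ j, (b i j) ^ 2 * Real.exp (y j) ≤ 1 / 4 * QY := by
      rw [hQY, Finset.mul_sum, Finset.sum_comm]
      refine Finset.sum_le_sum fun j _ => ?_
      rw [← Finset.sum_mul]
      have : ∑ i, b i j ^ 2 = ‖A (A (v j))‖ ^ 2 := by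
        rw [← sum_sq_inner_basis u]
      rw [this]; nlinarith [hA2 (v j), Real.exp_pos (y j)]
    have e6 : ∑ i, ∑ j, ((b i j) ^ 2 + 1 / 4 * ((y j - x i) * c i j) ^ 2) *
        (Real.exp (x i) + Real.exp (y j)) = ∑ i, ∑ j, (b i j) ^ 2 * Real.exp (x i) +
        ∑ i, ∑ j, (b i j) ^ 2 * Real.exp (y j) + 1 / 4 * (QX + QY) := by
      rw [hQX', hQY']
      simp only [← Finset.sum_add_distrib, Finset.mul_sum]
      exact Finset.sum_congr rfl fun i _ => Finset.sum_congr rfl fun j _ => by ring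
    linarith
  linarith

end Core

/-! ### Finite Bernoulli sampling -/

section Bernoulli

variable {κ : Type*} [Fintype κ]

/-- The probability of the pattern `ω` under independent Bernoulli(`p`) sampling. -/
noncomputable def bernoulliWeight (p : ℝ) (ω : κ → Bool) : ℝ := ∏ k, if ω k then p else 1 - p

/-- The centred indicator of `ω k`. -/
noncomputable def centred (p : ℝ) (ω : κ → Bool) (k : κ) : ℝ := (if ω k then 1 else 0) - p

lemma bernoulliWeight_nonneg {p : ℝ} (h0 : 0 ≤ p) (h1 : p ≤ 1) (ω : κ → Bool) :
    0 ≤ bernoulliWeight p ω :=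
  Finset.prod_nonneg fun k _ => by split_ifs <;> linarith

variable [DecidableEq κ]

/-- The probability of an event under independent Bernoulli(`p`) sampling. -/
noncomputable def bernoulliProb (p : ℝ) (G : Set (κ → Bool)) : ℝ :=
  ∑ ω, bernoulliWeight p ω * G.indicator 1 ω

lemma sum_bernoulliWeight (p : ℝ) : ∑ ω : κ → Bool, bernoulliWeight p ω = 1 := by
  have := Fintype.prod_sum (fun (_ : κ) (b : Bool) => if b then p else 1 - p)
  simp only [bernoulliWeight]
  rw [← this]; simp

lemma sum_eq_sum_filter_update (k : κ) (F : (κ → Bool) → ℝ) :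
    ∑ ω, F ω = ∑ ω with ω k = false, (F ω + F (Function.update ω k true)) := by
  rw [Finset.sum_add_distrib, ← Finset.sum_filter_add_sum_filter_not Finset.univ
    (fun ω : κ → Bool => ω k = false)]
  congr 1
  refine Finset.sum_bij' (fun ω _ => Function.update ω k false)
    (fun ω _ => Function.update ω k true) ?_ ?_ ?_ ?_ ?_
  · simp
  · simp
  · intro ω hω
    have : ω k = true := by simpa using hω
    simp [← this]
  · intro ω hω
    have : ω k = false := by simpa using hω
    simp [← this]
  · intro ω hω
    have : ω k = true := by simpa using hω
    simp [← this]

/-- Discrete integration by parts: with the other coordinates fixed, averaging (δ_k - p)h over δ_k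
gives p(1 - p) times the increment of h. The factor 1 - p is the weight of δ_k = 0, so bounding the
increment by g there costs at most p times the mean of g. -/
lemma sum_bernoulliWeight_mul_centred_le {p : ℝ} (h0 : 0 ≤ p) (h1 : p ≤ 1) (k : κ)
    {h g : (κ → Bool) → ℝ} (hg : ∀ ω, 0 ≤ g ω)
    (hh : ∀ ω, ω k = false → h (Function.update ω k true) - h ω ≤ g ω) :
    ∑ ω, bernoulliWeight p ω * (centred p ω k * h ω) ≤ p * ∑ ω, bernoulliWeight p ω * g ω := by
  rw [sum_eq_sum_filter_update k]
  refine le_trans (b := p * ∑ ω with ω k = false, bernoulliWeight p ω * g ω) ?_ ?_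
  · rw [Finset.mul_sum]
    refine Finset.sum_le_sum fun ω hω => ?_
    have hω : ω k = false := by simpa using hω
    set R := ∏ j ∈ Finset.univ.erase k, if ω j then p else 1 - p with hR
    have hR0 : 0 ≤ R := Finset.prod_nonneg fun k _ => by split_ifs <;> linarith
    have e1 : bernoulliWeight p ω = (1 - p) * R := by
      rw [bernoulliWeight, ← Finset.mul_prod_erase _ _ (Finset.mem_univ k)]; simp [hω, hR]
    have e2 : bernoulliWeight p (Function.update ω k true) = p * R := by
      rw [bernoulliWeight, ← Finset.mul_prod_erase _ _ (Finset.mem_univ k)]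
      simp only [Function.update_self, if_true, hR]
      congr 1
      refine Finset.prod_congr rfl fun j hj => ?_
      rw [Function.update_of_ne (Finset.ne_of_mem_erase hj)]
    rw [e1, e2]
    simp only [centred, hω, Function.update_self]
    have := mul_le_mul_of_nonneg_left (hh ω hω)
      (mul_nonneg (mul_nonneg h0 (sub_nonneg.2 h1)) hR0)
    simp only [Bool.false_eq_true, if_false, if_true]
    nlinarith
  · refine mul_le_mul_of_nonneg_left ?_ h0
    exact Finset.sum_le_sum_of_subset_of_nonneg (Finset.filter_subset _ _) fun ω _ _ =>
      mul_nonneg (bernoulliWeight_nonneg h0 h1 ω) (hg ω)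

lemma bernoulliProb_mono {p : ℝ} (h0 : 0 ≤ p) (h1 : p ≤ 1) {G G' : Set (κ → Bool)} (h : G ⊆ G') :
    bernoulliProb p G ≤ bernoulliProb p G' := by
  classical
  refine Finset.sum_le_sum fun ω _ => mul_le_mul_of_nonneg_left ?_ (bernoulliWeight_nonneg h0 h1 ω)
  exact Set.indicator_le_indicator_of_subset h (by simp) ω

lemma bernoulliProb_union_le {p : ℝ} (h0 : 0 ≤ p) (h1 : p ≤ 1) (G G' : Set (κ → Bool)) :
    bernoulliProb p (G ∪ G') ≤ bernoulliProb p G + bernoulliProb p G' := by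
  classical
  rw [bernoulliProb, bernoulliProb, bernoulliProb, ← Finset.sum_add_distrib]
  refine Finset.sum_le_sum fun ω _ => ?_
  rw [← mul_add]
  refine mul_le_mul_of_nonneg_left ?_ (bernoulliWeight_nonneg h0 h1 ω)
  simp only [Set.indicator, Set.mem_union]
  split_ifs <;> simp_all

lemma bernoulliProb_empty (p : ℝ) : bernoulliProb p (∅ : Set (κ → Bool)) = 0 := by
  simp [bernoulliProb]

lemma bernoulliProb_iUnion_le {p : ℝ} (h0 : 0 ≤ p) (h1 : p ≤ 1) {τ : Type*} [Fintype τ]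
    (G : τ → Set (κ → Bool)) {c : ℝ} (hG : ∀ i, bernoulliProb p (G i) ≤ c) :
    bernoulliProb p (⋃ i, G i) ≤ Fintype.card τ * c := by
  classical
  have : ∀ s : Finset τ, bernoulliProb p (⋃ i ∈ s, G i) ≤ s.card * c := by
    intro s
    induction s using Finset.induction_on with
    | empty => simp [bernoulliProb_empty]
    | insert a s ha ih =>
      rw [Finset.set_biUnion_insert, Finset.card_insert_of_notMem ha]
      refine (bernoulliProb_union_le h0 h1 _ _).trans ?_
      push_cast; linarith [hG a]
  simpa using this Finset.univ

lemma bernoulliProb_le_sum {p : ℝ} (h0 : 0 ≤ p) (h1 : p ≤ 1) {G : Set (κ → Bool)}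
    {f : (κ → Bool) → ℝ} (hf : ∀ ω, 0 ≤ f ω) (hG : ∀ ω ∈ G, 1 ≤ f ω) :
    bernoulliProb p G ≤ ∑ ω, bernoulliWeight p ω * f ω := by
  classical
  refine Finset.sum_le_sum fun ω _ => mul_le_mul_of_nonneg_left ?_ (bernoulliWeight_nonneg h0 h1 ω)
  simp only [Set.indicator]
  split_ifs with h
  · exact hG ω h
  · exact hf ω

lemma bernoulliProb_le_one {p : ℝ} (h0 : 0 ≤ p) (h1 : p ≤ 1)
    (G : Set (κ → Bool)) : bernoulliProb p G ≤ 1 := by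
  refine (bernoulliProb_le_sum h0 h1 (f := fun _ => 1) (by simp) (by simp)).trans ?_
  simp [sum_bernoulliWeight]

lemma bernoulliWeight_or (p q : ℝ) (ω : κ → Bool) :
    bernoulliWeight (1 - (1 - p) * (1 - q)) ω =
      ∑ ω₁ : κ → Bool, ∑ ω₂ : κ → Bool, bernoulliWeight p ω₁ * bernoulliWeight q ω₂ *
        if (fun k => ω₁ k || ω₂ k) = ω then 1 else 0 := by
  have e : ∀ ω₁ ω₂ : κ → Bool, (bernoulliWeight p ω₁ * bernoulliWeight q ω₂ *
        if (fun k => ω₁ k || ω₂ k) = ω then 1 else 0) =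
      ∏ k, ((if ω₁ k then p else 1 - p) * (if ω₂ k then q else 1 - q) *
        if (ω₁ k || ω₂ k) = ω k then 1 else 0) := by
    intro ω₁ ω₂
    rw [Finset.prod_mul_distrib, Finset.prod_mul_distrib, bernoulliWeight, bernoulliWeight]
    congr 1
    rw [Finset.prod_ite_zero]
    simp [funext_iff]
  simp_rw [e]
  have e2 : ∀ ω₁ : κ → Bool, ∑ ω₂ : κ → Bool,
      ∏ k, ((if ω₁ k then p else 1 - p) * (if ω₂ k then q else 1 - q) *
        if (ω₁ k || ω₂ k) = ω k then 1 else 0) = ∏ k, ∑ b : Bool,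
        ((if ω₁ k then p else 1 - p) * (if b then q else 1 - q) *
        if (ω₁ k || b) = ω k then 1 else 0) := fun ω₁ => (Fintype.prod_sum (fun (k : κ) (b : Bool) =>
        ((if ω₁ k then p else 1 - p) * (if b then q else 1 - q) *
        if (ω₁ k || b) = ω k then (1 : ℝ) else 0))).symm
  simp_rw [e2]
  have e3 := Fintype.prod_sum (fun (k : κ) (a : Bool) => ∑ b : Bool,
        ((if a then p else 1 - p) * (if b then q else 1 - q) *
        if (a || b) = ω k then (1 : ℝ) else 0))
  rw [← e3, bernoulliWeight]
  refine Finset.prod_congr rfl fun k _ => ?_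
  cases ω k <;> simp; ring

/-- The union of independent Bernoulli(`p`) and Bernoulli(`q`) samples is a
Bernoulli(`1 - (1 - p) (1 - q)`) sample. -/
lemma bernoulliProb_or (p q : ℝ) (G : Set (κ → Bool)) :
    bernoulliProb (1 - (1 - p) * (1 - q)) G =
      ∑ ω₁ : κ → Bool, bernoulliWeight p ω₁ *
        bernoulliProb q {ω₂ : κ → Bool | (fun k => ω₁ k || ω₂ k) ∈ G} := by
  classical
  simp only [bernoulliProb, bernoulliWeight_or, Finset.mul_sum, Finset.sum_mul]
  rw [Finset.sum_comm]
  refine Finset.sum_congr rfl fun ω₁ _ => ?_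
  rw [Finset.sum_comm]
  refine Finset.sum_congr rfl fun ω₂ _ => ?_
  rw [Finset.sum_eq_single (fun k => ω₁ k || ω₂ k)]
  · simp [Set.indicator]
  · intro b _ hb
    rw [if_neg (Ne.symm hb)]; simp
  · simp

end Bernoulli

/-! ### A matrix Bernstein inequality for Bernoulli sampling -/

section Bernstein

variable {κ : Type*} [Fintype κ] {E : Type*} [NormedAddCommGroup E] [InnerProductSpace ℝ E]

lemma isSymmetric_sum_smul (c : κ → ℝ) {A : κ → E →ₗ[ℝ] E} (hA : ∀ k, (A k).IsSymmetric) :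
    (∑ k, c k • A k).IsSymmetric := by
  intro x y
  simp only [LinearMap.sum_apply, LinearMap.smul_apply, sum_inner, inner_sum,
    real_inner_smul_left, inner_smul_right, hA _ x y]

variable [DecidableEq κ] [FiniteDimensional ℝ E]

/-- A Grönwall argument for the trace moment generating function m. Its derivative is ∑ E (δ_k - p)
tr A_k e^{θX}; switching δ_k on adds θA_k to the exponent, where ‖θA_k‖ ≤ 1/2, so each increment is
at most 4θ tr A_k² e^{θX}. Summing over k with `hV` gives m' ≤ 4pVθ m, so m(θ) exp(-2pVθ²) decreases
from its value at 0, the dimension. -/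
lemma sum_bernoulliWeight_mul_sum_exp_le {p L V θ₀ : ℝ} (h0 : 0 ≤ p) (h1 : p ≤ 1)
    {A : κ → E →ₗ[ℝ] E} (hA : ∀ k, (A k).IsSymmetric) (hL : ∀ k z, ‖A k z‖ ≤ L * ‖z‖)
    (hV : ∀ z, ∑ k, ‖A k z‖ ^ 2 ≤ V * ‖z‖ ^ 2) (hθ₀ : 0 ≤ θ₀) (hθL : θ₀ * L ≤ 1 / 2) :
    ∑ ω : κ → Bool, bernoulliWeight p ω * ∑ i, Real.exp (θ₀ *
      (isSymmetric_sum_smul (centred p ω) hA).eigenvalues rfl i)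
      ≤ Module.finrank ℝ E * Real.exp (2 * p * V * θ₀ ^ 2) := by
  set hX := fun ω => isSymmetric_sum_smul (centred p ω) hA with hXdef
  set x := fun ω => (hX ω).eigenvalues rfl with hx
  set u := fun ω => (hX ω).eigenvectorBasis rfl with hu
  have hxu : ∀ ω i, (∑ k, centred p ω k • A k) (u ω i) = x ω i • u ω i := fun ω i =>
    (hX ω).apply_eigenvectorBasis rfl i
  set m : ℝ → ℝ := fun θ => ∑ ω : κ → Bool, bernoulliWeight p ω * ∑ i, Real.exp (θ * x ω i) with hm
  set m' : ℝ → ℝ := fun θ =>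
    ∑ ω : κ → Bool, bernoulliWeight p ω * ∑ i, Real.exp (θ * x ω i) * x ω i with hm'
  have hder : ∀ θ, HasDerivAt m (m' θ) θ := by
    intro θ
    refine HasDerivAt.fun_sum fun ω _ => HasDerivAt.const_mul _ (HasDerivAt.fun_sum fun i _ => ?_)
    have : HasDerivAt (fun θ : ℝ => θ * x ω i) (x ω i) θ := by
      simpa using (hasDerivAt_id θ).mul_const (x ω i)
    exact this.exp
  have hbound : ∀ θ, 0 < θ → θ ≤ θ₀ → m' θ ≤ 4 * p * V * θ * m θ := by
    intro θ hθ hθ1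
    set h : κ → (κ → Bool) → ℝ := fun k ω =>
      ∑ i, Real.exp (θ * x ω i) * inner ℝ (u ω i) (A k (u ω i)) with hh
    set g : κ → (κ → Bool) → ℝ := fun k ω =>
      ∑ i, Real.exp (θ * x ω i) * ‖A k (u ω i)‖ ^ 2 with hg
    have e1 : m' θ = ∑ k, ∑ ω : κ → Bool, bernoulliWeight p ω * (centred p ω k * h k ω) := by
      rw [Finset.sum_comm]
      refine Finset.sum_congr rfl fun ω _ => ?_
      rw [← Finset.mul_sum]
      congr 1
      simp only [hh, Finset.mul_sum]
      rw [Finset.sum_comm]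
      refine Finset.sum_congr rfl fun i _ => ?_
      have : x ω i = inner ℝ (u ω i) ((∑ k, centred p ω k • A k) (u ω i)) := by
        rw [hxu, inner_smul_right]; simp
      generalize Real.exp (θ * x ω i) = e
      rw [this]
      simp only [LinearMap.sum_apply, LinearMap.smul_apply, inner_sum, inner_smul_right,
        Finset.mul_sum]
      exact Finset.sum_congr rfl fun k _ => by ring
    have e2 : ∀ k, ∑ ω : κ → Bool, bernoulliWeight p ω * (centred p ω k * h k ω) ≤
        p * ∑ ω : κ → Bool, bernoulliWeight p ω * (4 * θ * g k ω) := by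
      intro k
      refine sum_bernoulliWeight_mul_centred_le h0 h1 k ?_ ?_
      · intro ω
        have : 0 ≤ g k ω := Finset.sum_nonneg fun i _ => by positivity
        positivity
      · intro ω hω
        have hs : ∀ c : ℝ, ∀ B : E →ₗ[ℝ] E, B.IsSymmetric → (c • B).IsSymmetric := by
          intro c B hB y z
          simp [real_inner_smul_left, inner_smul_right, hB y z]
        have key := trace_mul_exp_sub_exp_le (u ω) (u (Function.update ω k true))
          (X := θ • ∑ j, centred p ω j • A j)
          (Y := θ • ∑ j, centred p (Function.update ω k true) j • A j) (A := θ • A k)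
          (x := fun i => θ * x ω i) (y := fun i => θ * x (Function.update ω k true) i)
          (hs _ _ (hX ω)) (hs _ _ (hA k)) ?_ ?_ ?_ ?_
        · simp only [LinearMap.smul_apply, inner_smul_right, norm_smul, mul_pow,
            Real.norm_eq_abs, sq_abs] at key
          have key2 : θ * (h k (Function.update ω k true) - h k ω) ≤ θ * (4 * θ * g k ω) := by
            simp only [hh, hg, mul_sub, Finset.mul_sum]
            simp only [Finset.mul_sum] at key
            refine le_trans (le_of_eq ?_) (key.trans (le_of_eq ?_))
            · congr 1 <;> exact Finset.sum_congr rfl fun i _ => by ring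
            · exact Finset.sum_congr rfl fun i _ => by ring
          exact le_of_mul_le_mul_left key2 hθ
        · rw [← smul_add]
          congr 1
          rw [← Finset.add_sum_erase _ _ (Finset.mem_univ k),
            ← Finset.add_sum_erase (a := k) Finset.univ (fun j => centred p ω j • A j)
              (Finset.mem_univ k)]
          have : ∑ j ∈ Finset.univ.erase k, centred p (Function.update ω k true) j • A j =
              ∑ j ∈ Finset.univ.erase k, centred p ω j • A j := by
            refine Finset.sum_congr rfl fun j hj => ?_
            simp [centred, Function.update_of_ne (Finset.ne_of_mem_erase hj)]
          rw [this]
          simp only [centred, Function.update_self, hω]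
          simp only [if_true, Bool.false_eq_true, if_false, sub_smul, one_smul, zero_smul]
          abel
        · intro i; rw [LinearMap.smul_apply, hxu, smul_smul]
        · intro i; rw [LinearMap.smul_apply, hxu, smul_smul]
        · intro z
          rw [LinearMap.smul_apply, norm_smul, Real.norm_eq_abs, abs_of_pos hθ]
          rcases le_or_gt 0 L with hL0 | hL0
          · calc θ * ‖A k z‖ ≤ θ * (L * ‖z‖) := mul_le_mul_of_nonneg_left (hL k z) hθ.le
              _ = θ * L * ‖z‖ := by ring
              _ ≤ 1 / 2 * ‖z‖ := mul_le_mul_of_nonneg_right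
                ((mul_le_mul_of_nonneg_right hθ1 hL0).trans hθL) (norm_nonneg _)
          · have hz := norm_nonneg z
            have : ‖A k z‖ = 0 := le_antisymm ((hL k z).trans
              (mul_nonpos_of_nonpos_of_nonneg hL0.le hz)) (norm_nonneg _)
            rw [this]; linarith
    rw [e1]
    refine (Finset.sum_le_sum fun k _ => e2 k).trans ?_
    rw [← Finset.mul_sum, Finset.sum_comm]
    have e3 : ∀ ω : κ → Bool, ∑ k, bernoulliWeight p ω * (4 * θ * g k ω) ≤
        4 * θ * V * (bernoulliWeight p ω * ∑ i, Real.exp (θ * x ω i)) := by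
      intro ω
      have : ∑ k, g k ω ≤ V * ∑ i, Real.exp (θ * x ω i) := by
        simp only [hg]
        rw [Finset.sum_comm, Finset.mul_sum]
        refine Finset.sum_le_sum fun i _ => ?_
        rw [← Finset.mul_sum, mul_comm V]
        refine mul_le_mul_of_nonneg_left ?_ (Real.exp_pos _).le
        simpa using hV (u ω i)
      rw [← Finset.mul_sum, ← Finset.mul_sum]
      have := mul_le_mul_of_nonneg_left this
        (mul_nonneg (bernoulliWeight_nonneg h0 h1 ω) (by positivity : 0 ≤ 4 * θ))
      linarith
    calc _ ≤ p * ∑ ω : κ → Bool, 4 * θ * V * (bernoulliWeight p ω * ∑ i, Real.exp (θ * x ω i)) :=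
          mul_le_mul_of_nonneg_left (Finset.sum_le_sum fun ω _ => e3 ω) h0
      _ = _ := by rw [← Finset.mul_sum]; ring
  have hanti : AntitoneOn (fun θ => m θ * Real.exp (-(2 * p * V * θ ^ 2))) (Set.Icc 0 θ₀) := by
    have hd : ∀ θ, HasDerivAt (fun θ => m θ * Real.exp (-(2 * p * V * θ ^ 2)))
        (m' θ * Real.exp (-(2 * p * V * θ ^ 2)) +
          m θ * (Real.exp (-(2 * p * V * θ ^ 2)) * (-(2 * p * V * (2 * θ))))) θ := by
      intro θ
      refine (hder θ).mul (HasDerivAt.exp ?_)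
      have := (((hasDerivAt_id θ).fun_pow 2).const_mul (2 * p * V)).fun_neg
      simpa using this
    refine antitoneOn_of_deriv_nonpos (convex_Icc _ _)
      (fun θ _ => (hd θ).continuousAt.continuousWithinAt)
      (fun θ _ => (hd θ).differentiableAt.differentiableWithinAt) ?_
    intro θ hθ
    rw [interior_Icc] at hθ
    rw [(hd θ).deriv]
    have := hbound θ hθ.1 hθ.2.le
    have he := Real.exp_pos (-(2 * p * V * θ ^ 2))
    nlinarith [mul_le_mul_of_nonneg_right this he.le]
  have hfin := hanti (Set.left_mem_Icc.2 hθ₀) (Set.right_mem_Icc.2 hθ₀) hθ₀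
  have hm0 : m 0 = Module.finrank ℝ E := by
    simp [hm, ← Finset.sum_mul, sum_bernoulliWeight]
  simp only [hm0] at hfin
  have h2 : m θ₀ = m θ₀ * Real.exp (-(2 * p * V * θ₀ ^ 2)) * Real.exp (2 * p * V * θ₀ ^ 2) := by
    rw [mul_assoc, ← Real.exp_add]; simp
  change m θ₀ ≤ _
  rw [h2]
  refine mul_le_mul_of_nonneg_right (hfin.trans ?_) (Real.exp_pos _).le
  simp

/-- Matrix Bernstein inequality for the largest eigenvalue of `∑ (δ_k - p) A_k`. -/
lemma bernoulliProb_quadratic_form_gt_le {p L V t γ : ℝ} (h0 : 0 ≤ p) (h1 : p ≤ 1)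
    {A : κ → E →ₗ[ℝ] E} (hA : ∀ k, (A k).IsSymmetric) (hL : ∀ k z, ‖A k z‖ ≤ L * ‖z‖)
    (hV : ∀ z, ∑ k, ‖A k z‖ ^ 2 ≤ V * ‖z‖ ^ 2) (ht : 0 < t) (hγ : 0 ≤ γ)
    (hVt : 8 * p * V * γ ≤ t ^ 2) (hLt : 4 * L * γ ≤ t) :
    bernoulliProb p {ω | ∃ z, t * ‖z‖ ^ 2 < inner ℝ z ((∑ k, centred p ω k • A k) z)}
      ≤ Module.finrank ℝ E * Real.exp (-γ) := by
  -- This θ makes Markov's factor e^{-2γ}, while `hVt` keeps the variance exponent at most γ and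
  -- `hLt` gives θL ≤ 1/2.
  set θ := 2 * γ / t with hθ
  have hθ0 : 0 ≤ θ := by positivity
  have hmgf := sum_bernoulliWeight_mul_sum_exp_le h0 h1 hA hL hV hθ0
    (by rw [hθ, div_mul_eq_mul_div, div_le_iff₀ ht]; linarith)
  refine (bernoulliProb_le_sum h0 h1 (f := fun ω => Real.exp (-(θ * t)) * ∑ i, Real.exp (θ *
      (isSymmetric_sum_smul (centred p ω) hA).eigenvalues rfl i)) ?_ ?_).trans ?_
  · intro ω
    exact mul_nonneg (Real.exp_pos _).le (Finset.sum_nonneg fun _ _ => (Real.exp_pos _).le)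
  · rintro ω ⟨z, hz⟩
    set hX := isSymmetric_sum_smul (centred p ω) hA with hXdef
    obtain ⟨i, hi⟩ : ∃ i, t ≤ hX.eigenvalues rfl i := by
      by_contra hcon
      push Not at hcon
      refine absurd hz (not_lt.2 ?_)
      set u := hX.eigenvectorBasis rfl with hu
      rw [← sum_inner_mul_inner_basis u, ← sum_sq_inner_basis u, Finset.mul_sum]
      refine Finset.sum_le_sum fun i _ => ?_
      rw [← hX, hX.apply_eigenvectorBasis, ← hu]
      simp only [real_inner_smul_left, RCLike.ofReal_real_eq_id, id]
      nlinarith [hcon i, sq_nonneg (inner ℝ (u i) z)]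
    have h2 : Real.exp (θ * t) ≤ ∑ i, Real.exp (θ * hX.eigenvalues rfl i) :=
      (Real.exp_le_exp.2 (mul_le_mul_of_nonneg_left hi hθ0)).trans
        (Finset.single_le_sum (f := fun i => Real.exp (θ * hX.eigenvalues rfl i))
          (fun _ _ => (Real.exp_pos _).le) (Finset.mem_univ i))
    calc (1 : ℝ) = Real.exp (-(θ * t)) * Real.exp (θ * t) := by rw [← Real.exp_add]; simp
      _ ≤ _ := mul_le_mul_of_nonneg_left h2 (Real.exp_pos _).le
  · have e : ∑ ω : κ → Bool, bernoulliWeight p ω * (Real.exp (-(θ * t)) * ∑ i, Real.exp (θ *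
        (isSymmetric_sum_smul (centred p ω) hA).eigenvalues rfl i)) = Real.exp (-(θ * t)) *
        ∑ ω : κ → Bool, bernoulliWeight p ω * ∑ i, Real.exp (θ *
        (isSymmetric_sum_smul (centred p ω) hA).eigenvalues rfl i) := by
      rw [Finset.mul_sum]; exact Finset.sum_congr rfl fun ω _ => by ring
    rw [e]
    refine (mul_le_mul_of_nonneg_left hmgf (Real.exp_pos _).le).trans ?_
    rw [mul_left_comm, ← Real.exp_add]
    refine mul_le_mul_of_nonneg_left (Real.exp_le_exp.2 ?_) (Nat.cast_nonneg _)
    have e1 : θ * t = 2 * γ := by rw [hθ]; field_simp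
    have e2 : 2 * p * V * θ ^ 2 = 8 * p * V * γ * γ / t ^ 2 := by rw [hθ]; field_simp; ring
    have e3 : 8 * p * V * γ * γ / t ^ 2 ≤ γ := by
      rw [div_le_iff₀ (by positivity)]
      nlinarith
    linarith

end Bernstein

/-! ### Rectangular sums through the self-adjoint dilation. -/

section Rectangular

variable {m n : Type*} [Fintype m] [Fintype n]

/-- `OpLe Z c` says that the spectral norm of `Z` is at most `c`, in terms of the bilinear
form of `Z`. -/
def OpLe (Z : Matrix m n ℝ) (c : ℝ) : Prop :=
  ∀ (x : m → ℝ) (y : n → ℝ), 2 * (x ⬝ᵥ Z *ᵥ y) ≤ c * (x ⬝ᵥ x + y ⬝ᵥ y)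

lemma norm_sq_toLp (x : m → ℝ) : ‖WithLp.toLp 2 x‖ ^ 2 = x ⬝ᵥ x := by
  rw [EuclideanSpace.norm_sq_eq]; simp [dotProduct, sq]

variable [DecidableEq m] [DecidableEq n] {κ : Type*} [Fintype κ] [DecidableEq κ]

/-- Matrix Bernstein inequality for the spectral norm of `∑ (δ_k - p) B_k`. -/
lemma bernoulliProb_not_opLe_le {p L V t γ : ℝ} (h0 : 0 ≤ p) (h1 : p ≤ 1)
    {B : κ → Matrix m n ℝ} (hL0 : 0 ≤ L)
    (hL : ∀ k y, (B k *ᵥ y) ⬝ᵥ (B k *ᵥ y) ≤ L ^ 2 * (y ⬝ᵥ y))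
    (hL' : ∀ k x, ((B k)ᵀ *ᵥ x) ⬝ᵥ ((B k)ᵀ *ᵥ x) ≤ L ^ 2 * (x ⬝ᵥ x))
    (hV : ∀ y, ∑ k, (B k *ᵥ y) ⬝ᵥ (B k *ᵥ y) ≤ V * (y ⬝ᵥ y))
    (hV' : ∀ x, ∑ k, ((B k)ᵀ *ᵥ x) ⬝ᵥ ((B k)ᵀ *ᵥ x) ≤ V * (x ⬝ᵥ x))
    (ht : 0 < t) (hγ : 0 ≤ γ) (hVt : 8 * p * V * γ ≤ t ^ 2) (hLt : 4 * L * γ ≤ t) :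
    bernoulliProb p {ω | ¬ OpLe (∑ k, centred p ω k • B k) t}
      ≤ (Fintype.card m + Fintype.card n) * Real.exp (-γ) := by
  -- The symmetric dilation with off-diagonal blocks B and Bᵀ: its quadratic form at (x, y) is 2
  -- x·By, exactly the form in `OpLe`, and its squared norm splits into the two hypotheses on B and
  -- Bᵀ.
  set A : κ → EuclideanSpace ℝ (m ⊕ n) →ₗ[ℝ] EuclideanSpace ℝ (m ⊕ n) := fun k =>
    Matrix.toEuclideanLin (Matrix.fromBlocks 0 (B k) (B k)ᵀ 0) with hA
  have hsym : ∀ k, (A k).IsSymmetric := by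
    intro k
    rw [hA, Matrix.isSymmetric_toEuclideanLin_iff, Matrix.IsHermitian,
      Matrix.conjTranspose_eq_transpose_of_trivial, Matrix.fromBlocks_transpose]
    simp
  have happ : ∀ k (z : EuclideanSpace ℝ (m ⊕ n)), A k z = WithLp.toLp 2
      (Sum.elim (B k *ᵥ (z.ofLp ∘ Sum.inr)) ((B k)ᵀ *ᵥ (z.ofLp ∘ Sum.inl))) := by
    intro k z
    rw [hA, Matrix.toLpLin_apply, Matrix.fromBlocks_mulVec]
    simp
  have hz : ∀ z : EuclideanSpace ℝ (m ⊕ n), ‖z‖ ^ 2 =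
      (z.ofLp ∘ Sum.inl) ⬝ᵥ (z.ofLp ∘ Sum.inl) + (z.ofLp ∘ Sum.inr) ⬝ᵥ (z.ofLp ∘ Sum.inr) := by
    intro z
    rw [EuclideanSpace.norm_sq_eq]; simp [dotProduct, sq]
  have hnorm : ∀ k (z : EuclideanSpace ℝ (m ⊕ n)), ‖A k z‖ ^ 2 =
      (B k *ᵥ (z.ofLp ∘ Sum.inr)) ⬝ᵥ (B k *ᵥ (z.ofLp ∘ Sum.inr)) +
      ((B k)ᵀ *ᵥ (z.ofLp ∘ Sum.inl)) ⬝ᵥ ((B k)ᵀ *ᵥ (z.ofLp ∘ Sum.inl)) := by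
    intro k z
    rw [hz, happ]; simp
  have hmain := bernoulliProb_quadratic_form_gt_le (A := A) (L := L) (V := V) h0 h1 hsym ?_ ?_
    ht hγ hVt hLt
  · refine (bernoulliProb_mono h0 h1 ?_).trans (hmain.trans (le_of_eq (by simp)))
    intro ω hω
    simp only [Set.mem_ofPred_eq, OpLe] at hω
    push Not at hω
    obtain ⟨x, y, hxy⟩ := hω
    refine ⟨WithLp.toLp 2 (Sum.elim x y), ?_⟩
    rw [hz]
    refine lt_of_lt_of_eq hxy ?_
    simp only [LinearMap.sum_apply, LinearMap.smul_apply, happ, inner_sum, inner_smul_right,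
      EuclideanSpace.inner_toLp_toLp, Matrix.sum_mulVec, Matrix.smul_mulVec, dotProduct_sum,
      dotProduct_smul, Finset.mul_sum, smul_eq_mul]
    refine Finset.sum_congr rfl fun k _ => ?_
    have e : y ⬝ᵥ (B k)ᵀ *ᵥ x = x ⬝ᵥ B k *ᵥ y := by
      rw [Matrix.mulVec_transpose, dotProduct_comm, Matrix.dotProduct_mulVec]
    simp only [Sum.elim_comp_inl, Sum.elim_comp_inr, star_trivial,
      sumElim_dotProduct_sumElim]
    rw [dotProduct_comm (B k *ᵥ y), dotProduct_comm ((B k)ᵀ *ᵥ x), e]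
    ring
  · intro k z
    refine le_of_sq_le_sq ?_ (by positivity)
    rw [hnorm, mul_pow, hz]
    linarith [hL k (z.ofLp ∘ Sum.inr), hL' k (z.ofLp ∘ Sum.inl)]
  · intro z
    simp only [hnorm, hz, Finset.sum_add_distrib]
    linarith [hV (z.ofLp ∘ Sum.inr), hV' (z.ofLp ∘ Sum.inl)]

end Rectangular

/-! ### The Frobenius inner product -/

section Frobenius

variable {m n : Type*} [Fintype m] [Fintype n]

/-- The Frobenius inner product of two real matrices. -/
def frob (A B : Matrix m n ℝ) : ℝ := ∑ k : m × n, A k.1 k.2 * B k.1 k.2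

lemma frob_eq_trace (A B : Matrix m n ℝ) : frob A B = (Aᵀ * B).trace := by
  simp only [frob, Matrix.trace, Matrix.diag, Matrix.mul_apply, Matrix.transpose_apply]
  rw [Fintype.sum_prod_type, Finset.sum_comm]

lemma frob_comm (A B : Matrix m n ℝ) : frob A B = frob B A :=
  Finset.sum_congr rfl fun _ _ => mul_comm _ _

lemma frob_add_left (A B C : Matrix m n ℝ) : frob (A + B) C = frob A C + frob B C := by
  simp [frob, add_mul, Finset.sum_add_distrib]

lemma frob_sub_left (A B C : Matrix m n ℝ) : frob (A - B) C = frob A C - frob B C := by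
  simp [frob, sub_mul, Finset.sum_sub_distrib]

lemma frob_add_right (A B C : Matrix m n ℝ) : frob A (B + C) = frob A B + frob A C := by
  simp [frob, mul_add, Finset.sum_add_distrib]

lemma frob_zero_right (A : Matrix m n ℝ) : frob A 0 = 0 := by simp [frob]

lemma frob_self_nonneg (A : Matrix m n ℝ) : 0 ≤ frob A A :=
  Finset.sum_nonneg fun _ _ => mul_self_nonneg _

lemma frob_self_eq_zero {A : Matrix m n ℝ} : frob A A = 0 ↔ A = 0 := by
  constructor
  · intro h
    ext i j
    have := (Finset.sum_eq_zero_iff_of_nonneg (fun k _ => mul_self_nonneg (A k.1 k.2))).1 h (i, j)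
      (Finset.mem_univ _)
    simpa using this
  · rintro rfl; exact frob_zero_right _

lemma frob_mul_left (P : Matrix m m ℝ) (A B : Matrix m n ℝ) :
    frob (P * A) B = frob A (Pᵀ * B) := by
  simp [frob_eq_trace, Matrix.transpose_mul, Matrix.mul_assoc]

lemma frob_mul_right (A B : Matrix m n ℝ) (Q : Matrix n n ℝ) :
    frob (A * Q) B = frob A (B * Qᵀ) := by
  rw [frob_eq_trace, frob_eq_trace, Matrix.transpose_mul, Matrix.mul_assoc, Matrix.trace_mul_comm,
    Matrix.mul_assoc]

lemma frob_sq_le (A B : Matrix m n ℝ) : frob A B ^ 2 ≤ frob A A * frob B B := by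
  have := Finset.sum_mul_sq_le_sq_mul_sq Finset.univ (fun k : m × n => A k.1 k.2)
    (fun k => B k.1 k.2)
  simpa [frob, sq] using this

lemma frob_eq_sum_dotProduct (Z X : Matrix m n ℝ) {ι : Type*} [Fintype ι]
    (v : OrthonormalBasis ι ℝ (EuclideanSpace ℝ n)) :
    frob Z X = ∑ i, (Z *ᵥ (v i).ofLp) ⬝ᵥ (X *ᵥ (v i).ofLp) := by
  simp only [dotProduct, frob]
  rw [Fintype.sum_prod_type, Finset.sum_comm (s := (Finset.univ : Finset ι))]
  refine Finset.sum_congr rfl fun a _ => ?_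
  have := sum_inner_mul_inner_basis v (WithLp.toLp 2 (Z a)) (WithLp.toLp 2 (X a))
  simp only [EuclideanSpace.inner_eq_star_dotProduct, star_trivial] at this
  rw [dotProduct_comm] at this
  exact this.symm

end Frobenius

/-! ### Elementary spectral norm bounds. -/

section OpLe

variable {m n : Type*} [Fintype m] [Fintype n]

lemma OpLe.add {A B : Matrix m n ℝ} {a b : ℝ} (hA : OpLe A a) (hB : OpLe B b) :
    OpLe (A + B) (a + b) := by
  intro x y
  rw [Matrix.add_mulVec, dotProduct_add]
  linarith [hA x y, hB x y]

lemma OpLe.smul {A : Matrix m n ℝ} {a : ℝ} (hA : OpLe A a) {c : ℝ} (hc : 0 ≤ c) :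
    OpLe (c • A) (c * a) := by
  intro x y
  rw [Matrix.smul_mulVec, dotProduct_smul, smul_eq_mul]
  nlinarith [mul_le_mul_of_nonneg_left (hA x y) hc]

lemma two_mul_dotProduct_le (x y : m → ℝ) : 2 * (x ⬝ᵥ y) ≤ x ⬝ᵥ x + y ⬝ᵥ y := by
  simp only [dotProduct, Finset.mul_sum, ← Finset.sum_add_distrib]
  exact Finset.sum_le_sum fun i _ => by nlinarith [sq_nonneg (x i - y i)]

lemma dotProduct_self_nonneg' (x : m → ℝ) : 0 ≤ x ⬝ᵥ x :=
  Finset.sum_nonneg fun _ _ => mul_self_nonneg _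

lemma mulVec_dotProduct_mulVec (A B : Matrix m n ℝ) (x y : n → ℝ) :
    (A *ᵥ x) ⬝ᵥ (B *ᵥ y) = x ⬝ᵥ (Aᵀ * B) *ᵥ y := by
  rw [← Matrix.mulVec_mulVec, Matrix.dotProduct_mulVec x, Matrix.vecMul_transpose]

lemma opLe_of_frob_le {A : Matrix m n ℝ} {c : ℝ} (hc : 0 ≤ c) (h : frob A A ≤ c ^ 2) :
    OpLe A c := by
  intro x y
  have e1 : x ⬝ᵥ A *ᵥ y = ∑ k : m × n, A k.1 k.2 * (x k.1 * y k.2) := by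
    rw [Fintype.sum_prod_type]
    simp only [dotProduct, Matrix.mulVec, Finset.mul_sum]
    exact Finset.sum_congr rfl fun i _ => Finset.sum_congr rfl fun j _ => by ring
  have e2 : (x ⬝ᵥ A *ᵥ y) ^ 2 ≤ c ^ 2 * ((x ⬝ᵥ x) * (y ⬝ᵥ y)) := by
    rw [e1]
    refine (Finset.sum_mul_sq_le_sq_mul_sq _ _ _).trans ?_
    have e3 : ∑ k : m × n, (x k.1 * y k.2) ^ 2 = (x ⬝ᵥ x) * (y ⬝ᵥ y) := by
      rw [Fintype.sum_prod_type]
      simp only [dotProduct, Finset.sum_mul_sum]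
      exact Finset.sum_congr rfl fun i _ => Finset.sum_congr rfl fun j _ => by ring
    have e4 : ∑ k : m × n, A k.1 k.2 ^ 2 = frob A A := by simp [frob, sq]
    rw [e3, e4]
    exact mul_le_mul_of_nonneg_right h
      (mul_nonneg (dotProduct_self_nonneg' x) (dotProduct_self_nonneg' y))
  refine le_of_sq_le_sq ?_ (mul_nonneg hc
    (add_nonneg (dotProduct_self_nonneg' x) (dotProduct_self_nonneg' y)))
  nlinarith [mul_nonneg (sq_nonneg c) (sq_nonneg (x ⬝ᵥ x - y ⬝ᵥ y))]

end OpLe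

/-! ### Duality for the nuclear norm -/

section Nuclear

variable {n₁ n₂ : ℕ}

lemma nuclearNorm_eq_sum (X : Matrix (Fin n₁) (Fin n₂) ℝ) :
    nuclearNorm X = ∑ i : Fin n₂, (Matrix.toEuclideanLin X).singularValues i := by
  rw [nuclearNorm, Finsupp.sum_of_support_subset (s := Finset.range n₂), Finset.sum_range]
  · intro i hi
    rw [Finset.mem_range]
    by_contra h
    rw [Finsupp.mem_support_iff] at hi
    exact hi (LinearMap.singularValues_of_finrank_le _ (by simpa using h))
  · simp

lemma exists_singular_basis (X : Matrix (Fin n₁) (Fin n₂) ℝ) :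
    ∃ (s : Fin n₂ → ℝ) (v : OrthonormalBasis (Fin n₂) ℝ (EuclideanSpace ℝ (Fin n₂))),
      (∀ i, 0 ≤ s i) ∧ nuclearNorm X = ∑ i, s i ∧
      ∀ i j, (X *ᵥ (v i).ofLp) ⬝ᵥ (X *ᵥ (v j).ofLp) = if i = j then s i ^ 2 else 0 := by
  set T := Matrix.toEuclideanLin X with hT
  have hn : Module.finrank ℝ (EuclideanSpace ℝ (Fin n₂)) = n₂ := by simp
  set v := T.isSymmetric_adjoint_comp_self.eigenvectorBasis hn with hv
  refine ⟨fun i => T.singularValues i, v, fun i => T.singularValues_nonneg i,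
    nuclearNorm_eq_sum X, fun i j => ?_⟩
  have e : (X *ᵥ (v i).ofLp) ⬝ᵥ (X *ᵥ (v j).ofLp) = inner ℝ (T (v i)) (T (v j)) := by
    rw [EuclideanSpace.inner_eq_star_dotProduct, dotProduct_comm]; simp [hT, Matrix.toLpLin_apply]
  rw [e, ← LinearMap.adjoint_inner_left, ← LinearMap.comp_apply, hv,
    LinearMap.IsSymmetric.apply_eigenvectorBasis, ← hv, ← T.sq_singularValues_fin hn,
    real_inner_smul_left, v.inner_eq_ite]
  simp

/-- Expand the inner product in the right singular basis of X and test the bilinear form of Z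
against each pair of left and right singular vectors; pairs with zero singular value contribute
nothing. -/
lemma frob_le_mul_nuclearNorm {Z X : Matrix (Fin n₁) (Fin n₂) ℝ} {c : ℝ} (hZ : OpLe Z c) :
    frob Z X ≤ c * nuclearNorm X := by
  obtain ⟨s, v, hs, hnuc, horth⟩ := exists_singular_basis X
  rw [frob_eq_sum_dotProduct Z X v, hnuc, Finset.mul_sum]
  refine Finset.sum_le_sum fun i _ => ?_
  have hii := horth i i
  rw [if_pos rfl] at hii
  rcases (hs i).eq_or_lt with h0 | h0
  · have : X *ᵥ (v i).ofLp = 0 := by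
      rw [← dotProduct_self_eq_zero, hii, ← h0]; simp
    rw [this, ← h0]; simp
  · have hv1 : (v i).ofLp ⬝ᵥ (v i).ofLp = 1 := by
      rw [← norm_sq_toLp]; simp
    have h := hZ ((s i)⁻¹ • X *ᵥ (v i).ofLp) (v i).ofLp
    rw [smul_dotProduct, smul_dotProduct, dotProduct_smul, hii, hv1, dotProduct_comm] at h
    simp only [smul_eq_mul] at h
    have e1 : (s i)⁻¹ * ((s i)⁻¹ * s i ^ 2) = 1 := by field_simp
    rw [e1] at h
    have h2 : (s i)⁻¹ * (Z *ᵥ (v i).ofLp ⬝ᵥ X *ᵥ (v i).ofLp) ≤ c := by linarith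
    rwa [inv_mul_le_iff₀ h0, mul_comm] at h2

lemma exists_opLe_frob_eq_nuclearNorm (X : Matrix (Fin n₁) (Fin n₂) ℝ) :
    ∃ W : Matrix (Fin n₁) (Fin n₂) ℝ, OpLe W 1 ∧ frob W X = nuclearNorm X := by
  obtain ⟨s, v, hs, hnuc, horth⟩ := exists_singular_basis X
  -- Left singular vectors. Since 0⁻¹ = 0, those with zero singular value vanish, so W is the
  -- partial isometry of the polar decomposition, with spectral norm at most 1.
  set w : Fin n₂ → Fin n₁ → ℝ := fun i => (s i)⁻¹ • X *ᵥ (v i).ofLp with hw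
  set W : Matrix (Fin n₁) (Fin n₂) ℝ := ∑ i, Matrix.vecMulVec (w i) (v i).ofLp with hWdef
  have hWy : ∀ y, W *ᵥ y = ∑ i, ((v i).ofLp ⬝ᵥ y) • w i := by
    intro y
    rw [hWdef, Matrix.sum_mulVec]
    refine Finset.sum_congr rfl fun i _ => ?_
    rw [Matrix.vecMulVec_mulVec]; simp
  have hvv : ∀ i j, (v i).ofLp ⬝ᵥ (v j).ofLp = if i = j then 1 else 0 := by
    intro i j
    rw [← v.inner_eq_ite, EuclideanSpace.inner_eq_star_dotProduct, dotProduct_comm]; simp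
  have hww : ∀ i j, i ≠ j → w i ⬝ᵥ w j = 0 := by
    intro i j hij
    simp [hw, smul_dotProduct, dotProduct_smul, horth, hij]
  have hwi : ∀ i, w i ⬝ᵥ w i ≤ 1 := by
    intro i
    simp only [hw, smul_dotProduct, dotProduct_smul, horth, if_true, smul_eq_mul]
    rcases eq_or_ne (s i) 0 with h | h
    · simp [h]
    · exact le_of_eq (by field_simp)
  refine ⟨W, fun x y => ?_, ?_⟩
  · have h1 := two_mul_dotProduct_le x (W *ᵥ y)
    have h2 : (W *ᵥ y) ⬝ᵥ (W *ᵥ y) ≤ y ⬝ᵥ y := by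
      have e1 : (W *ᵥ y) ⬝ᵥ (W *ᵥ y) = ∑ i, ((v i).ofLp ⬝ᵥ y) ^ 2 * (w i ⬝ᵥ w i) := by
        rw [hWy, sum_dotProduct]
        refine Finset.sum_congr rfl fun i _ => ?_
        rw [dotProduct_sum, Finset.sum_eq_single i]
        · simp only [smul_dotProduct, dotProduct_smul, smul_eq_mul]; ring
        · intro j _ hj
          simp [smul_dotProduct, dotProduct_smul, hww i j hj.symm]
        · simp
      have e2 : y ⬝ᵥ y = ∑ i, ((v i).ofLp ⬝ᵥ y) ^ 2 := by
        rw [← norm_sq_toLp, ← sum_sq_inner_basis v]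
        refine Finset.sum_congr rfl fun i _ => ?_
        rw [EuclideanSpace.inner_eq_star_dotProduct, dotProduct_comm]; simp
      rw [e1, e2]
      refine Finset.sum_le_sum fun i _ => ?_
      nlinarith [hwi i, sq_nonneg ((v i).ofLp ⬝ᵥ y)]
    linarith
  · rw [frob_eq_sum_dotProduct W X v, hnuc]
    refine Finset.sum_congr rfl fun i _ => ?_
    have : W *ᵥ (v i).ofLp = w i := by
      rw [hWy, Finset.sum_eq_single i]
      · simp [hvv]
      · intro j _ hj; simp [hvv, hj]
      · simp
    rw [this, hw]
    simp only [smul_dotProduct, horth, if_true, smul_eq_mul]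
    rcases eq_or_ne (s i) 0 with h | h
    · simp [h]
    · field_simp

/-- Pair X with itself: its spectral norm is at most its Frobenius norm, so duality gives ‖X‖_F² ≤
‖X‖_F ‖X‖_*. -/
lemma frob_self_le_nuclearNorm_sq (X : Matrix (Fin n₁) (Fin n₂) ℝ) :
    frob X X ≤ nuclearNorm X ^ 2 := by
  have h := frob_le_mul_nuclearNorm (X := X)
    (opLe_of_frob_le (Real.sqrt_nonneg _) (Real.sq_sqrt (frob_self_nonneg X)).ge)
  have h2 := Real.sq_sqrt (frob_self_nonneg X)
  have h3 := Real.sqrt_nonneg (frob X X)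
  rcases h3.eq_or_lt with h4 | h4
  · rw [← h2, ← h4]; nlinarith [sq_nonneg (nuclearNorm X)]
  · nlinarith

lemma nuclearNorm_nonneg (X : Matrix (Fin n₁) (Fin n₂) ℝ) : 0 ≤ nuclearNorm X := by
  rw [nuclearNorm_eq_sum]
  exact Finset.sum_nonneg fun i _ => LinearMap.singularValues_nonneg _ _

end Nuclear

/-! ### The tangent space and the optimality certificate -/

section Tangent

variable {m n : Type*} [Fintype m] [Fintype n]

/-- A matrix of an orthogonal projection. -/
structure IsProj (P : Matrix m m ℝ) : Prop where
  symm : Pᵀ = P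
  idem : P * P = P

lemma IsProj.one_sub [DecidableEq m] {P : Matrix m m ℝ} (hP : IsProj P) : IsProj (1 - P) where
  symm := by rw [Matrix.transpose_sub, hP.symm, Matrix.transpose_one]
  idem := by simp [mul_sub, sub_mul, hP.idem]

lemma IsProj.mulVec_dotProduct_self {P : Matrix m m ℝ} (hP : IsProj P) (x : m → ℝ) :
    (P *ᵥ x) ⬝ᵥ (P *ᵥ x) = x ⬝ᵥ P *ᵥ x := by
  rw [mulVec_dotProduct_mulVec, hP.symm, hP.idem]

lemma IsProj.mulVec_dotProduct_self_le [DecidableEq m] {P : Matrix m m ℝ} (hP : IsProj P) (x : m → ℝ) :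
    (P *ᵥ x) ⬝ᵥ (P *ᵥ x) ≤ x ⬝ᵥ x := by
  have h := dotProduct_self_nonneg' ((1 - P) *ᵥ x)
  rw [hP.one_sub.mulVec_dotProduct_self, Matrix.sub_mulVec, Matrix.one_mulVec, dotProduct_sub,
    ← hP.mulVec_dotProduct_self] at h
  linarith

/-- The orthogonal projection `Z ↦ PZ + ZQ - PZQ` onto the tangent space. -/
def tangentProj (P : Matrix m m ℝ) (Q : Matrix n n ℝ) : Matrix m n ℝ →ₗ[ℝ] Matrix m n ℝ where
  toFun Z := P * Z + Z * Q - P * Z * Q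
  map_add' A B := by simp only [Matrix.mul_add, Matrix.add_mul]; abel
  map_smul' c A := by
    simp only [Matrix.mul_smul, Matrix.smul_mul, RingHom.id_apply, smul_add, smul_sub]

lemma tangentProj_apply {P : Matrix m m ℝ} {Q : Matrix n n ℝ} (Z : Matrix m n ℝ) :
    tangentProj P Q Z = P * Z + Z * Q - P * Z * Q := rfl

lemma isProj_mul_transpose {r : Type*} [Fintype r] [DecidableEq r] {U : Matrix m r ℝ}
    (hU : Uᵀ * U = 1) : IsProj (U * Uᵀ) where
  symm := by simp
  idem := by rw [Matrix.mul_assoc, ← Matrix.mul_assoc Uᵀ, hU, Matrix.one_mul]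

lemma tangentProj_mul_mul {r : Type*} [Fintype r] [DecidableEq r] {U : Matrix m r ℝ}
    {V : Matrix n r ℝ} (hU : Uᵀ * U = 1) (D : Matrix r r ℝ) :
    tangentProj (U * Uᵀ) (V * Vᵀ) (U * D * Vᵀ) = U * D * Vᵀ := by
  have h : U * Uᵀ * (U * D * Vᵀ) = U * D * Vᵀ := by
    rw [Matrix.mul_assoc U D, ← Matrix.mul_assoc, Matrix.mul_assoc U, hU, Matrix.mul_one]
  rw [tangentProj_apply, h]; simp

variable [DecidableEq m] [DecidableEq n]

/-- The orthogonal projection `Z ↦ (1 - P)Z(1 - Q)` onto the normal space. -/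
def normalProj (P : Matrix m m ℝ) (Q : Matrix n n ℝ) : Matrix m n ℝ →ₗ[ℝ] Matrix m n ℝ where
  toFun Z := (1 - P) * Z * (1 - Q)
  map_add' A B := by simp only [Matrix.mul_add, Matrix.add_mul]
  map_smul' c A := by simp only [Matrix.mul_smul, Matrix.smul_mul, RingHom.id_apply]

variable {P : Matrix m m ℝ} {Q : Matrix n n ℝ}

lemma normalProj_apply (Z : Matrix m n ℝ) : normalProj P Q Z = (1 - P) * Z * (1 - Q) := rfl

lemma tangentProj_add_normalProj (Z : Matrix m n ℝ) :
    tangentProj P Q Z + normalProj P Q Z = Z := by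
  rw [tangentProj_apply, normalProj_apply]
  simp only [Matrix.sub_mul, Matrix.mul_sub, Matrix.one_mul, Matrix.mul_one]
  abel

lemma frob_normalProj (hP : IsProj P) (hQ : IsProj Q) (A B : Matrix m n ℝ) :
    frob (normalProj P Q A) B = frob A (normalProj P Q B) := by
  rw [normalProj_apply, frob_mul_right, frob_mul_left, hP.one_sub.symm, hQ.one_sub.symm,
    normalProj_apply, Matrix.mul_assoc]

lemma tangentProj_eq_sub (Z : Matrix m n ℝ) : tangentProj P Q Z = Z - normalProj P Q Z :=
  eq_sub_of_add_eq (tangentProj_add_normalProj Z)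

lemma frob_tangentProj (hP : IsProj P) (hQ : IsProj Q) (A B : Matrix m n ℝ) :
    frob (tangentProj P Q A) B = frob A (tangentProj P Q B) := by
  rw [tangentProj_eq_sub, frob_sub_left, frob_normalProj hP hQ, tangentProj_eq_sub,
    frob_comm A (_ - _), frob_sub_left, frob_comm B, frob_comm _ A]

lemma normalProj_normalProj (hP : IsProj P) (hQ : IsProj Q) (Z : Matrix m n ℝ) :
    normalProj P Q (normalProj P Q Z) = normalProj P Q Z := by
  simp only [normalProj_apply]
  rw [← Matrix.mul_assoc, ← Matrix.mul_assoc, hP.one_sub.idem, Matrix.mul_assoc, hQ.one_sub.idem]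

lemma tangentProj_tangentProj (hP : IsProj P) (hQ : IsProj Q) (Z : Matrix m n ℝ) :
    tangentProj P Q (tangentProj P Q Z) = tangentProj P Q Z := by
  rw [tangentProj_eq_sub (tangentProj P Q Z), tangentProj_eq_sub Z, map_sub,
    normalProj_normalProj hP hQ]
  simp

lemma normalProj_eq_zero {Z : Matrix m n ℝ} (h : tangentProj P Q Z = Z) :
    normalProj P Q Z = 0 := by
  rw [tangentProj_eq_sub] at h
  simpa using h

lemma dotProduct_normalProj_mulVec (hP : IsProj P) (Z : Matrix m n ℝ) (x : m → ℝ) (y : n → ℝ) :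
    x ⬝ᵥ normalProj P Q Z *ᵥ y = ((1 - P) *ᵥ x) ⬝ᵥ Z *ᵥ ((1 - Q) *ᵥ y) := by
  rw [normalProj_apply, ← Matrix.mulVec_mulVec, ← Matrix.mulVec_mulVec, Matrix.dotProduct_mulVec,
    ← Matrix.mulVec_transpose, hP.one_sub.symm]

lemma OpLe.normalProj (hP : IsProj P) (hQ : IsProj Q) {Z : Matrix m n ℝ} {c : ℝ} (hc : 0 ≤ c)
    (hZ : OpLe Z c) : OpLe (normalProj P Q Z) c := by
  intro x y
  rw [dotProduct_normalProj_mulVec hP]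
  refine (hZ _ _).trans (mul_le_mul_of_nonneg_left ?_ hc)
  exact add_le_add (hP.one_sub.mulVec_dotProduct_self_le x)
    (hQ.one_sub.mulVec_dotProduct_self_le y)

variable {r : Type*} [Fintype r] [DecidableEq r] {U : Matrix m r ℝ} {V : Matrix n r ℝ}

/-- The two summands act on orthogonal pieces: UVᵀ sees only Px and Qy, the normal part only (1 -
P)x and (1 - Q)y, and the squared norms of the pieces add up. Such matrices are the subgradients of
the nuclear norm at `M`. -/
lemma opLe_mul_transpose_add_normalProj (hU : Uᵀ * U = 1) (hV : Vᵀ * V = 1) {W : Matrix m n ℝ}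
    (hW : OpLe W 1) : OpLe (U * Vᵀ + normalProj (U * Uᵀ) (V * Vᵀ) W) 1 := by
  intro x y
  have hP := isProj_mul_transpose hU
  have hQ := isProj_mul_transpose hV
  rw [Matrix.add_mulVec, dotProduct_add, dotProduct_normalProj_mulVec hP]
  have h1 := hW ((1 - U * Uᵀ) *ᵥ x) ((1 - V * Vᵀ) *ᵥ y)
  rw [hP.one_sub.mulVec_dotProduct_self, hQ.one_sub.mulVec_dotProduct_self, Matrix.sub_mulVec,
    Matrix.sub_mulVec, dotProduct_sub, dotProduct_sub, Matrix.one_mulVec, Matrix.one_mulVec] at h1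
  rw [Matrix.sub_mulVec, Matrix.sub_mulVec, Matrix.one_mulVec, Matrix.one_mulVec]
  have h2 := two_mul_dotProduct_le (Uᵀ *ᵥ x) (Vᵀ *ᵥ y)
  rw [mulVec_dotProduct_mulVec, mulVec_dotProduct_mulVec, Matrix.transpose_transpose,
    Matrix.transpose_transpose] at h2
  have h3 : (Uᵀ *ᵥ x) ⬝ᵥ (Vᵀ *ᵥ y) = x ⬝ᵥ (U * Vᵀ) *ᵥ y := by
    rw [← Matrix.mulVec_mulVec, Matrix.dotProduct_mulVec x, Matrix.mulVec_transpose]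
  rw [h3] at h2
  linarith

end Tangent

/-! ### Exact recovery from a dual certificate. -/

section Optimality

variable {n₁ n₂ r : ℕ} {M : Matrix (Fin n₁) (Fin n₂) ℝ}
  {U : Matrix (Fin n₁) (Fin r) ℝ} {σ : Fin r → ℝ} {V : Matrix (Fin n₂) (Fin r) ℝ}

/-- Links the nuclear norm, defined by `singularValues`, to the given decomposition: a dual matrix W
pairs with `M` to ∑ σ_k u_k·Wv_k ≤ ∑ σ_k = ⟨UVᵀ, M⟩. -/
lemma IsCompactSVD.nuclearNorm_le (h : IsCompactSVD M U σ V) :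
    nuclearNorm M ≤ frob (U * Vᵀ) M := by
  obtain ⟨W, hW, hWM⟩ := exists_opLe_frob_eq_nuclearNorm M
  rw [← hWM, frob_eq_trace, frob_eq_trace, h.eq]
  have e1 : ((U * Vᵀ)ᵀ * (U * Matrix.diagonal σ * Vᵀ)).trace = ∑ k, σ k := by
    rw [Matrix.transpose_mul, Matrix.transpose_transpose, Matrix.mul_assoc, Matrix.mul_assoc U,
      ← Matrix.mul_assoc Uᵀ, h.left_orthonormal, Matrix.one_mul, Matrix.trace_mul_comm,
      Matrix.mul_assoc, h.right_orthonormal, Matrix.mul_one, Matrix.trace_diagonal]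
  have e2 : (Wᵀ * (U * Matrix.diagonal σ * Vᵀ)).trace =
      ∑ k, σ k * ((U.col k) ⬝ᵥ W *ᵥ (V.col k)) := by
    have : (Wᵀ * (U * Matrix.diagonal σ * Vᵀ)).trace =
        ((Uᵀ * W * V)ᵀ * Matrix.diagonal σ).trace := by
      rw [← Matrix.mul_assoc, Matrix.trace_mul_comm]
      simp only [Matrix.transpose_mul, Matrix.transpose_transpose, Matrix.mul_assoc]
    rw [this, Matrix.trace]
    refine Finset.sum_congr rfl fun k _ => ?_
    rw [Matrix.diag_apply, Matrix.mul_diagonal, mul_comm, Matrix.transpose_apply,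
      Matrix.mul_assoc]
    rfl
  rw [e1, e2]
  refine Finset.sum_le_sum fun k _ => ?_
  have hu : U.col k ⬝ᵥ U.col k = 1 := by
    have := congrFun (congrFun h.left_orthonormal k) k
    simpa [Matrix.mul_apply, dotProduct] using this
  have hv : V.col k ⬝ᵥ V.col k = 1 := by
    have := congrFun (congrFun h.right_orthonormal k) k
    simpa [Matrix.mul_apply, dotProduct] using this
  have := hW (U.col k) (V.col k)
  rw [hu, hv] at this
  nlinarith [h.pos k]

/-- A dual certificate `Y` supported on the samples, together with well-conditioning of the
sampling operator on the tangent space, makes `M` the unique minimizer. -/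
lemma isUniqueOptimal_of_certificate (h : IsCompactSVD M U σ V) {Ω : Set (Fin n₁ × Fin n₂)}
    {a ε : ℝ} (ha : 0 < a) (hε : 4 * ε ^ 2 ≤ a) (Y : Matrix (Fin n₁) (Fin n₂) ℝ)
    (hYΩ : ∀ k ∉ Ω, Y k.1 k.2 = 0) (hYN : OpLe (normalProj (U * Uᵀ) (V * Vᵀ) Y) (1 / 4))
    (hYT : frob (tangentProj (U * Uᵀ) (V * Vᵀ) Y - U * Vᵀ)
      (tangentProj (U * Uᵀ) (V * Vᵀ) Y - U * Vᵀ) ≤ ε ^ 2)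
    (hA : ∀ H : Matrix (Fin n₁) (Fin n₂) ℝ, a * frob (tangentProj (U * Uᵀ) (V * Vᵀ) H)
      (tangentProj (U * Uᵀ) (V * Vᵀ) H) ≤
        ∑ k, Ω.indicator (fun k => (tangentProj (U * Uᵀ) (V * Vᵀ) H k.1 k.2) ^ 2) k) :
    IsUniqueOptimal M Ω M := by
  refine ⟨fun _ _ => rfl, fun X hX hXM => ?_⟩
  have hP := isProj_mul_transpose h.left_orthonormal
  have hQ := isProj_mul_transpose h.right_orthonormal
  set T := tangentProj (U * Uᵀ) (V * Vᵀ) with hT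
  set N := normalProj (U * Uᵀ) (V * Vᵀ) with hN
  set H := X - M with hH
  have hHΩ : ∀ k ∈ Ω, H k.1 k.2 = 0 := fun k hk => by
    rw [hH, Matrix.sub_apply, hX k hk, sub_self]
  have hH0 : H ≠ 0 := sub_ne_zero.2 hXM
  have hdecomp : T H + N H = H := tangentProj_add_normalProj H
  -- H vanishes on Ω, so TH = -NH there, and conditioning on the tangent space bounds all of TH by
  -- NH.
  have hTN : a * frob (T H) (T H) ≤ frob (N H) (N H) := by
    refine (hA H).trans (Finset.sum_le_sum fun k _ => ?_)
    by_cases hk : k ∈ Ω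
    · rw [Set.indicator_of_mem hk]
      have : T H k.1 k.2 = - N H k.1 k.2 := by
        have := congrFun (congrFun hdecomp k.1) k.2
        rw [Matrix.add_apply, hHΩ k hk] at this
        linarith
      rw [this]; exact le_of_eq (by ring)
    · rw [Set.indicator_of_notMem hk]; exact mul_self_nonneg _
  have hNpos : 0 < frob (N H) (N H) := by
    rcases (frob_self_nonneg (N H)).eq_or_lt with h0 | h0
    · exfalso
      rw [← h0] at hTN
      have h1 : frob (T H) (T H) = 0 := le_antisymm (by nlinarith) (frob_self_nonneg _)
      rw [frob_self_eq_zero.1 h1, frob_self_eq_zero.1 h0.symm, add_zero] at hdecomp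
      exact hH0 hdecomp.symm
    · exact h0
  obtain ⟨W, hW, hWN⟩ := exists_opLe_frob_eq_nuclearNorm (N H)
  have hZ := frob_le_mul_nuclearNorm (X := X)
    (opLe_mul_transpose_add_normalProj h.left_orthonormal h.right_orthonormal hW)
  rw [one_mul] at hZ
  have hTUV : T (U * Vᵀ) = U * Vᵀ := by
    have := tangentProj_mul_mul (V := V) h.left_orthonormal 1
    rwa [Matrix.mul_one] at this
  have hNM : N M = 0 := normalProj_eq_zero (by
    rw [h.eq]; exact tangentProj_mul_mul h.left_orthonormal _)
  have hXe : X = M + H := by rw [hH]; abel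
  have e1 : frob (U * Vᵀ + N W) X = frob (U * Vᵀ) M + frob (U * Vᵀ) (T H) + nuclearNorm (N H) := by
    rw [hXe, frob_add_right, frob_add_left, frob_add_left, frob_normalProj hP hQ W M,
      frob_normalProj hP hQ W H, ← hN, hNM, frob_zero_right, hWN, ← frob_tangentProj hP hQ, ← hT,
      hTUV]
    ring
  have e2 : frob (T Y) (T H) + frob (N Y) (N H) = 0 := by
    rw [frob_tangentProj hP hQ, frob_normalProj hP hQ, ← hT, ← hN, hT,
      tangentProj_tangentProj hP hQ, hN, normalProj_normalProj hP hQ, ← frob_add_right,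
      tangentProj_add_normalProj]
    refine Finset.sum_eq_zero fun k _ => ?_
    by_cases hk : k ∈ Ω
    · rw [hHΩ k hk, mul_zero]
    · rw [hYΩ k hk, zero_mul]
  have e3 : frob (N Y) (N H) ≤ 1 / 4 * nuclearNorm (N H) := frob_le_mul_nuclearNorm hYN
  -- Cauchy–Schwarz, ‖TH‖ ≤ ‖NH‖/√a and ε ≤ √a/2.
  have e4 : frob (T Y - U * Vᵀ) (T H) ≤ 1 / 2 * nuclearNorm (N H) := by
    refine le_of_sq_le_sq ?_ (by linarith [nuclearNorm_nonneg (N H)])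
    refine (frob_sq_le _ _).trans ?_
    have h1 := frob_self_le_nuclearNorm_sq (N H)
    have h2 := mul_le_mul_of_nonneg_right hYT (frob_self_nonneg (T H))
    have h3 := mul_le_mul_of_nonneg_right hε (frob_self_nonneg (T H))
    nlinarith
  rw [frob_sub_left] at e4
  have hnpos : 0 < nuclearNorm (N H) := by
    have := frob_self_le_nuclearNorm_sq (N H)
    exact (nuclearNorm_nonneg (N H)).lt_of_ne fun h0 => by rw [← h0] at this; nlinarith
  have hM := h.nuclearNorm_le
  rw [e1] at hZ
  -- The term ⟨UVᵀ, TH⟩ loses at most 1/4 + 1/2 of ‖NH‖_*, leaving a strict gain of a quarter.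
  linarith

lemma isUniqueOptimal_of_rank_zero (Ω : Set (Fin n₁ × Fin n₂)) :
    IsUniqueOptimal (0 : Matrix (Fin n₁) (Fin n₂) ℝ) Ω 0 := by
  refine ⟨fun _ _ => rfl, fun X _ hX => ?_⟩
  have h0 : nuclearNorm (0 : Matrix (Fin n₁) (Fin n₂) ℝ) = 0 := by simp [nuclearNorm_eq_sum]
  rw [h0]
  have h1 := frob_self_le_nuclearNorm_sq X
  refine (nuclearNorm_nonneg X).lt_of_ne fun h => hX ?_
  rw [← h] at h1
  exact frob_self_eq_zero.1 (le_antisymm (by simpa using h1) (frob_self_nonneg _))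

end Optimality

/-! ### Concentration of sampled tangent projections -/

section Vector

variable {m : Type*} [Fintype m]

lemma dotProduct_sq_le (x y : m → ℝ) : (x ⬝ᵥ y) ^ 2 ≤ (x ⬝ᵥ x) * (y ⬝ᵥ y) := by
  simpa [dotProduct, sq] using Finset.sum_mul_sq_le_sq_mul_sq Finset.univ x y

lemma dotProduct_unit (x y : Unit → ℝ) : x ⬝ᵥ y = x () * y () := by simp [dotProduct]

variable [DecidableEq m] {κ : Type*} [Fintype κ] [DecidableEq κ]

/-- Vector Bernstein inequality for `∑ (δ_k - p) v_k`. -/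
lemma bernoulliProb_sum_smul_gt_le {p L V t γ : ℝ} (h0 : 0 ≤ p) (h1 : p ≤ 1)
    {v : κ → m → ℝ} (hL0 : 0 ≤ L) (hL : ∀ k, v k ⬝ᵥ v k ≤ L ^ 2) (hV : ∑ k, v k ⬝ᵥ v k ≤ V)
    (ht : 0 < t) (hγ : 0 ≤ γ) (hVt : 8 * p * V * γ ≤ t ^ 2) (hLt : 4 * L * γ ≤ t) :
    bernoulliProb p {ω | t ^ 2 < (∑ k, centred p ω k • v k) ⬝ᵥ (∑ k, centred p ω k • v k)}
      ≤ (Fintype.card m + 1) * Real.exp (-γ) := by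
  -- Vectors are treated as one-column matrices, whose spectral norm is the Euclidean norm.
  set B : κ → Matrix m Unit ℝ := fun k => Matrix.vecMulVec (v k) (fun _ => 1) with hB
  have hBy : ∀ k y, (B k *ᵥ y) ⬝ᵥ (B k *ᵥ y) = (v k ⬝ᵥ v k) * (y ⬝ᵥ y) := by
    intro k y
    simp only [hB, Matrix.vecMulVec_mulVec, dotProduct_unit, smul_dotProduct, dotProduct_smul,
      MulOpposite.smul_eq_mul_unop, MulOpposite.unop_op]
    ring
  have hBx : ∀ k x, ((B k)ᵀ *ᵥ x) ⬝ᵥ ((B k)ᵀ *ᵥ x) = (v k ⬝ᵥ x) ^ 2 := by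
    intro k x
    simp only [hB, Matrix.transpose_vecMulVec, Matrix.vecMulVec_mulVec]
    simp [dotProduct, sq]
  have hx : ∀ k x, (v k ⬝ᵥ x) ^ 2 ≤ (v k ⬝ᵥ v k) * (x ⬝ᵥ x) := fun k x => dotProduct_sq_le _ _
  refine (bernoulliProb_mono h0 h1 ?_).trans ((bernoulliProb_not_opLe_le (B := B) h0 h1 hL0
    (fun k y => ?_) (fun k x => ?_) (fun y => ?_) (fun x => ?_) ht hγ hVt hLt).trans ?_)
  · intro ω hω
    simp only [Set.mem_ofPred_eq] at hω ⊢
    intro hop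
    set s := ∑ k, centred p ω k • v k with hs
    have hsum : ∀ y : Unit → ℝ, (∑ k, centred p ω k • B k) *ᵥ y = y () • s := by
      intro y
      rw [Matrix.sum_mulVec, hs, Finset.smul_sum]
      refine Finset.sum_congr rfl fun k _ => ?_
      rw [Matrix.smul_mulVec, hB, Matrix.vecMulVec_mulVec, smul_comm]
      simp [dotProduct]
    have h := hop s (fun _ => √(s ⬝ᵥ s))
    rw [hsum, dotProduct_smul] at h
    simp only [dotProduct_unit, smul_eq_mul] at h
    have hss := dotProduct_self_nonneg' s
    rw [Real.mul_self_sqrt hss] at h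
    have h3 : t < √(s ⬝ᵥ s) := Real.lt_sqrt_of_sq_lt hω
    have h4 : 0 < s ⬝ᵥ s := lt_of_le_of_lt (sq_nonneg t) hω
    nlinarith
  · rw [hBy]; exact mul_le_mul_of_nonneg_right (hL k) (dotProduct_self_nonneg' y)
  · rw [hBx]; exact (hx k x).trans (mul_le_mul_of_nonneg_right (hL k) (dotProduct_self_nonneg' x))
  · simp only [hBy]
    rw [← Finset.sum_mul]; exact mul_le_mul_of_nonneg_right hV (dotProduct_self_nonneg' y)
  · simp only [hBx]
    refine (Finset.sum_le_sum fun k _ => hx k x).trans ?_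
    rw [← Finset.sum_mul]; exact mul_le_mul_of_nonneg_right hV (dotProduct_self_nonneg' x)
  · simp

/-- Scalar Bernstein inequality for `∑ (δ_k - p) b_k`. -/
lemma bernoulliProb_abs_sum_gt_le {p L V t γ : ℝ} (h0 : 0 ≤ p) (h1 : p ≤ 1)
    {b : κ → ℝ} (hL0 : 0 ≤ L) (hL : ∀ k, b k ^ 2 ≤ L ^ 2) (hV : ∑ k, b k ^ 2 ≤ V)
    (ht : 0 < t) (hγ : 0 ≤ γ) (hVt : 8 * p * V * γ ≤ t ^ 2) (hLt : 4 * L * γ ≤ t) :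
    bernoulliProb p {ω | t < |∑ k, centred p ω k * b k|} ≤ 2 * Real.exp (-γ) := by
  have h := bernoulliProb_sum_smul_gt_le (m := Unit) (v := fun k _ => b k) (p := p) h0 h1 hL0
    (by simpa [sq] using hL) (by simpa [sq] using hV) ht hγ hVt hLt
  refine (bernoulliProb_mono h0 h1 ?_).trans (h.trans (by norm_num))
  intro ω hω
  simp only [Set.mem_ofPred_eq, dotProduct_unit, Finset.sum_apply, Pi.smul_apply,
    smul_eq_mul] at hω ⊢
  rw [← sq, sq_lt_sq, abs_of_pos ht]
  exact hω

end Vector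

/-! ### Sampling on the tangent space and the estimates for one golfing round. -/

section Sampling

variable {m n : Type*} [Fintype m] [Fintype n] {P : Matrix m m ℝ} {Q : Matrix n n ℝ}

lemma tangentProj_transpose (hP : IsProj P) (hQ : IsProj Q) (Z : Matrix m n ℝ) :
    (tangentProj P Q Z)ᵀ = tangentProj Q P Zᵀ := by
  simp only [tangentProj_apply, Matrix.transpose_sub, Matrix.transpose_add, Matrix.transpose_mul,
    hP.symm, hQ.symm, Matrix.mul_assoc]
  abel

lemma IsProj.sum_sq_apply (hP : IsProj P) (a : m) : ∑ i, P i a ^ 2 = P a a := by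
  conv_rhs => rw [← hP.idem, Matrix.mul_apply]
  refine Finset.sum_congr rfl fun i _ => ?_
  rw [sq, ← Matrix.transpose_apply P a i, hP.symm]

lemma IsProj.apply_self_nonneg (hP : IsProj P) (a : m) : 0 ≤ P a a := by
  rw [← hP.sum_sq_apply]; exact Finset.sum_nonneg fun _ _ => sq_nonneg _

/-- `Z` has entries at most `s ν` and rows and columns of squared norm at most `s² ν`. -/
structure IsSpread (ν s : ℝ) (Z : Matrix m n ℝ) : Prop where
  entry : ∀ i j, |Z i j| ≤ s * ν
  row : ∀ i, ∑ j, Z i j ^ 2 ≤ s ^ 2 * ν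
  col : ∀ j, ∑ i, Z i j ^ 2 ≤ s ^ 2 * ν

lemma IsSpread.sq_le {ν s : ℝ} {Z : Matrix m n ℝ} (h : IsSpread ν s Z) (i : m) (j : n) :
    Z i j ^ 2 ≤ (s * ν) ^ 2 := by
  rw [← sq_abs]; exact pow_le_pow_left₀ (abs_nonneg _) (h.entry i j) 2

variable [DecidableEq m] [DecidableEq n]

/-- The entries of `Z` at the sampled positions, and zero elsewhere. -/
def sampled (ω : m × n → Bool) (Z : Matrix m n ℝ) : Matrix m n ℝ :=
  Matrix.of fun i j => if ω (i, j) then Z i j else 0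

lemma frob_single (A : Matrix m n ℝ) (k : m × n) :
    frob A (Matrix.single k.1 k.2 1) = A k.1 k.2 := by
  rw [frob, Finset.sum_eq_single k]
  · simp
  · intro l _ hl
    rw [Matrix.single_apply_of_ne]
    · simp
    · rintro ⟨h1, h2⟩; exact hl (Prod.ext h1.symm h2.symm)
  · simp

lemma sum_centred_smul_single (p : ℝ) (ω : m × n → Bool) (Z : Matrix m n ℝ) :
    ∑ k : m × n, centred p ω k • Z k.1 k.2 • Matrix.single k.1 k.2 (1 : ℝ) =
      sampled ω Z - p • Z := by
  ext i j
  rw [Matrix.sum_apply, Finset.sum_eq_single (i, j)]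
  · simp only [centred, sampled, Matrix.smul_apply, Matrix.single_apply_same, smul_eq_mul,
      Matrix.sub_apply, Matrix.of_apply]
    split_ifs <;> ring
  · intro l _ hl
    rw [Matrix.smul_apply, Matrix.smul_apply, Matrix.single_apply_of_ne]
    · simp
    · rintro ⟨h1, h2⟩; exact hl (Prod.ext h1 h2)
  · simp

lemma tangentProj_sampled_sub_apply (p : ℝ) (ω : m × n → Bool) (Z : Matrix m n ℝ) (i : m) (j : n) :
    (tangentProj P Q (sampled ω Z) - p • tangentProj P Q Z) i j =
      ∑ k : m × n, centred p ω k *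
        (Z k.1 k.2 * tangentProj P Q (Matrix.single k.1 k.2 1) i j) := by
  rw [← map_smul, ← map_sub, ← sum_centred_smul_single, map_sum, Matrix.sum_apply]
  refine Finset.sum_congr rfl fun k _ => ?_
  rw [map_smul, map_smul, Matrix.smul_apply, Matrix.smul_apply, smul_eq_mul, smul_eq_mul]

lemma tangentProj_single_apply (k : m × n) (i : m) (j : n) :
    tangentProj P Q (Matrix.single k.1 k.2 1) i j =
      (if k.2 = j then P i k.1 else 0) + (1 - P) i k.1 * Q k.2 j := by
  have e1 : (P * Matrix.single k.1 k.2 (1 : ℝ)) i j = if k.2 = j then P i k.1 else 0 := by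
    by_cases h : k.2 = j
    · subst h; simp
    · rw [if_neg h, Matrix.mul_single_apply_of_ne]; exact fun h' => h h'.symm
  have e2 : ((1 - P) * Matrix.single k.1 k.2 (1 : ℝ) * Q : Matrix m n ℝ) =
      Matrix.single k.1 k.2 (1 : ℝ) * Q - P * Matrix.single k.1 k.2 (1 : ℝ) * Q := by
    simp [Matrix.sub_mul]
  have e3 : ((1 - P) * Matrix.single k.1 k.2 (1 : ℝ) * Q : Matrix m n ℝ) i j = (1 - P) i k.1 * Q k.2 j := by
    rw [Matrix.mul_apply, Finset.sum_eq_single k.2]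
    · simp
    · intro b _ hb
      rw [Matrix.mul_single_apply_of_ne _ _ _ _ _ hb, zero_mul]
    · simp
  rw [← e1, ← e3, e2, tangentProj_apply]
  simp only [Matrix.add_apply, Matrix.sub_apply]
  ring

/-- The bound keeps its dependence on the column of k: summed over columns it totals at most 4ν,
which the variance estimates need and a uniform bound in k would not give. -/
lemma sum_col_sq_tangentProj_single_le (hP : IsProj P) {ν : ℝ} (hPν : ∀ i, P i i ≤ ν)
    (k : m × n) (j : n) :
    ∑ i, tangentProj P Q (Matrix.single k.1 k.2 1) i j ^ 2 ≤
      2 * (if k.2 = j then ν else 0) + 2 * Q k.2 j ^ 2 := by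
  have h1 : ∑ i, (1 - P) i k.1 ^ 2 ≤ 1 := by
    rw [hP.one_sub.sum_sq_apply, Matrix.sub_apply, Matrix.one_apply_eq]
    linarith [hP.apply_self_nonneg k.1]
  calc _ ≤ ∑ i, (2 * (if k.2 = j then P i k.1 ^ 2 else 0) +
        2 * Q k.2 j ^ 2 * (1 - P) i k.1 ^ 2) := by
        refine Finset.sum_le_sum fun i _ => ?_
        rw [tangentProj_single_apply]
        split_ifs
        · nlinarith [sq_nonneg (P i k.1 - (1 - P) i k.1 * Q k.2 j)]
        · nlinarith [sq_nonneg ((1 - P) i k.1 * Q k.2 j)]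
    _ ≤ _ := by
        rw [Finset.sum_add_distrib, ← Finset.mul_sum, ← Finset.mul_sum]
        refine add_le_add ?_ ?_
        · split_ifs
          · rw [hP.sum_sq_apply]; linarith [hPν k.1]
          · simp
        · nlinarith [sq_nonneg (Q k.2 j)]

lemma sum_row_sq_tangentProj_single_le (hP : IsProj P) (hQ : IsProj Q) {ν : ℝ}
    (hQν : ∀ j, Q j j ≤ ν) (k : m × n) (i : m) :
    ∑ j, tangentProj P Q (Matrix.single k.1 k.2 1) i j ^ 2 ≤
      2 * (if k.1 = i then ν else 0) + 2 * P k.1 i ^ 2 := by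
  have h := sum_col_sq_tangentProj_single_le (Q := P) hQ hQν k.swap i
  refine le_trans (le_of_eq (Finset.sum_congr rfl fun j _ => ?_)) h
  rw [← Matrix.transpose_apply (tangentProj P Q _), tangentProj_transpose hP hQ,
    Matrix.transpose_single]
  rfl

/-- As T is an orthogonal projection, the left side is the diagonal coefficient ⟨Te, e⟩ = P_aa +
Q_bb - P_aa Q_bb. -/
lemma frob_tangentProj_single_self_le (hP : IsProj P) (hQ : IsProj Q) {ν : ℝ}
    (hPν : ∀ i, P i i ≤ ν) (hQν : ∀ j, Q j j ≤ ν) (k : m × n) :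
    frob (tangentProj P Q (Matrix.single k.1 k.2 1)) (tangentProj P Q (Matrix.single k.1 k.2 1))
      ≤ 2 * ν := by
  rw [frob_comm, ← frob_tangentProj hP hQ, tangentProj_tangentProj hP hQ, frob_single,
    tangentProj_single_apply, if_pos rfl, Matrix.sub_apply, Matrix.one_apply_eq]
  nlinarith [hPν k.1, hQν k.2, hP.apply_self_nonneg k.1, hQ.apply_self_nonneg k.2,
    mul_nonneg (hP.apply_self_nonneg k.1) (hQ.apply_self_nonneg k.2)]

lemma frob_tangentProj_self_le (hP : IsProj P) (hQ : IsProj Q) (H : Matrix m n ℝ) :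
    frob (tangentProj P Q H) (tangentProj P Q H) ≤ frob H H := by
  have h1 := frob_self_nonneg (normalProj P Q H)
  rw [frob_normalProj hP hQ, normalProj_normalProj hP hQ] at h1
  rw [frob_tangentProj hP hQ, tangentProj_tangentProj hP hQ]
  have h2 : frob H H = frob H (tangentProj P Q H) + frob H (normalProj P Q H) := by
    rw [← frob_add_right, tangentProj_add_normalProj]
  linarith

lemma tangentProj_single_apply_eq_frob (hP : IsProj P) (hQ : IsProj Q) (H : Matrix m n ℝ)
    (k : m × n) : frob (tangentProj P Q (Matrix.single k.1 k.2 1)) H =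
      tangentProj P Q H k.1 k.2 := by
  rw [frob_tangentProj hP hQ, frob_comm, frob_single]

/-- With high probability the sampling operator is well conditioned on the tangent space. -/
lemma bernoulliProb_not_injective_le (hP : IsProj P) (hQ : IsProj Q) {ν p γ : ℝ} (hν : 0 ≤ ν)
    (hPν : ∀ i, P i i ≤ ν) (hQν : ∀ j, Q j j ≤ ν) (hp0 : 0 < p) (hp1 : p ≤ 1) (hγ : 0 ≤ γ)
    (hpγ : 64 * ν * γ ≤ p) :
    bernoulliProb p {ω : m × n → Bool | ¬ ∀ H : Matrix m n ℝ,
      p / 2 * frob (tangentProj P Q H) (tangentProj P Q H) ≤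
        ∑ k, if ω k then tangentProj P Q H k.1 k.2 ^ 2 else 0} ≤
      2 * Fintype.card (m × n) * Real.exp (-γ) := by
  set w : m × n → m × n → ℝ := fun k l =>
    tangentProj P Q (Matrix.single k.1 k.2 1) l.1 l.2 with hw
  -- On vectorised matrices these rank-one terms sum to T, and weighted by the sampling indicators
  -- to T followed by sampling and T again. Since ‖w_k‖² ≤ 2ν, Bernstein applies with L = V = 2ν.
  set B : m × n → Matrix (m × n) (m × n) ℝ := fun k => Matrix.vecMulVec (w k) (w k) with hB
  have hww : ∀ k, w k ⬝ᵥ w k ≤ 2 * ν := fun k =>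
    frob_tangentProj_single_self_le hP hQ hPν hQν k
  have hwH : ∀ k (H : Matrix m n ℝ), (w k ⬝ᵥ fun l => H l.1 l.2) = tangentProj P Q H k.1 k.2 :=
    fun k H => tangentProj_single_apply_eq_frob hP hQ H k
  have hBy : ∀ k y, B k *ᵥ y = (w k ⬝ᵥ y) • w k := by
    intro k y; rw [hB, Matrix.vecMulVec_mulVec]; simp
  have hBn : ∀ k y, (B k *ᵥ y) ⬝ᵥ (B k *ᵥ y) = (w k ⬝ᵥ y) ^ 2 * (w k ⬝ᵥ w k) := by
    intro k y
    rw [hBy, smul_dotProduct, dotProduct_smul, smul_eq_mul, smul_eq_mul]; ring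
  have hBt : ∀ k, (B k)ᵀ = B k := fun k => Matrix.transpose_vecMulVec _ _
  have hL : ∀ k y, (B k *ᵥ y) ⬝ᵥ (B k *ᵥ y) ≤ (2 * ν) ^ 2 * (y ⬝ᵥ y) := by
    intro k y
    rw [hBn]
    have h1 := dotProduct_sq_le (w k) y
    have h2 := dotProduct_self_nonneg' (w k)
    have h3 := dotProduct_self_nonneg' y
    calc (w k ⬝ᵥ y) ^ 2 * (w k ⬝ᵥ w k)
        ≤ ((w k ⬝ᵥ w k) * (y ⬝ᵥ y)) * (w k ⬝ᵥ w k) := mul_le_mul_of_nonneg_right h1 h2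
      _ = (w k ⬝ᵥ w k) ^ 2 * (y ⬝ᵥ y) := by ring
      _ ≤ _ := mul_le_mul_of_nonneg_right (pow_le_pow_left₀ h2 (hww k) 2) h3
  have hV : ∀ y, ∑ k, (B k *ᵥ y) ⬝ᵥ (B k *ᵥ y) ≤ (2 * ν) * (y ⬝ᵥ y) := by
    intro y
    set H : Matrix m n ℝ := Matrix.of fun i j => y (i, j) with hH
    have hyH : y = fun l : m × n => H l.1 l.2 := rfl
    calc ∑ k, (B k *ᵥ y) ⬝ᵥ (B k *ᵥ y) ≤ ∑ k, (2 * ν) * (w k ⬝ᵥ y) ^ 2 := by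
          refine Finset.sum_le_sum fun k _ => ?_
          rw [hBn, mul_comm]
          exact mul_le_mul_of_nonneg_right (hww k) (sq_nonneg _)
      _ = (2 * ν) * frob (tangentProj P Q H) (tangentProj P Q H) := by
          rw [← Finset.mul_sum, frob]
          congr 1
          exact Finset.sum_congr rfl fun k _ => by rw [hyH, hwH, sq]
      _ ≤ _ := mul_le_mul_of_nonneg_left (frob_tangentProj_self_le hP hQ H) (by linarith)
  have hmain := bernoulliProb_not_opLe_le (p := p) (L := 2 * ν) (V := 2 * ν) (t := p / 2) (γ := γ)
    (B := B) hp0.le hp1 (by linarith) hL (by simpa only [hBt] using hL) hV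
    (by simpa only [hBt] using hV) (by linarith) hγ (by nlinarith) (by linarith)
  refine (bernoulliProb_mono hp0.le hp1 ?_).trans (hmain.trans (le_of_eq (by ring)))
  intro ω hω hop
  refine hω fun H => ?_
  -- Testing at (-z, z) turns the spectral bound into a lower bound on the quadratic form.
  have h := hop (fun l => - tangentProj P Q H l.1 l.2) (fun l => tangentProj P Q H l.1 l.2)
  have hneg : (fun l : m × n => - tangentProj P Q H l.1 l.2) =
      -(fun l : m × n => tangentProj P Q H l.1 l.2) := rfl
  have hself : (fun l : m × n => tangentProj P Q H l.1 l.2) ⬝ᵥ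
      (fun l : m × n => tangentProj P Q H l.1 l.2) =
      frob (tangentProj P Q H) (tangentProj P Q H) := rfl
  rw [hneg, neg_dotProduct, neg_dotProduct, dotProduct_neg, hself, Matrix.sum_mulVec,
    dotProduct_sum] at h
  have e1 : ∀ k, ((fun l : m × n => tangentProj P Q H l.1 l.2) ⬝ᵥ (centred p ω k • B k) *ᵥ
      fun l : m × n => tangentProj P Q H l.1 l.2) =
      (if ω k then tangentProj P Q H k.1 k.2 ^ 2 else 0) -
        p * (tangentProj P Q H k.1 k.2 * tangentProj P Q H k.1 k.2) := by
    intro k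
    rw [Matrix.smul_mulVec, hBy, dotProduct_smul, dotProduct_smul, dotProduct_comm _ (w k), hwH,
      tangentProj_tangentProj hP hQ, centred]
    simp only [smul_eq_mul]
    split_ifs <;> ring
  simp only [e1, Finset.sum_sub_distrib, ← Finset.mul_sum] at h
  have e2 : ∑ k : m × n, tangentProj P Q H k.1 k.2 * tangentProj P Q H k.1 k.2 =
    frob (tangentProj P Q H) (tangentProj P Q H) := rfl
  rw [e2] at h
  linarith

variable {ν s q γ : ℝ} {Z : Matrix m n ℝ}

/-- Here the size parameter is the largest entry and the variance is the largest squared row or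
column norm, precisely what `IsSpread` controls. With deviation qs/8 the variance condition reads
512νγ ≤ q, the source of that constant. -/
lemma bernoulliProb_sampled_opLe (hZ : IsSpread ν s Z) (hν : 0 ≤ ν) (hs : 0 < s)
    (hq0 : 0 < q) (hq1 : q ≤ 1) (hγ : 0 ≤ γ) (hqγ : 512 * ν * γ ≤ q) :
    bernoulliProb q {ω : m × n → Bool | ¬ OpLe (q⁻¹ • sampled ω Z - Z) (s / 8)} ≤
      (Fintype.card m + Fintype.card n) * Real.exp (-γ) := by
  set B : m × n → Matrix m n ℝ := fun k => Z k.1 k.2 • Matrix.single k.1 k.2 (1 : ℝ) with hB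
  have hBy : ∀ k y, (B k *ᵥ y) ⬝ᵥ (B k *ᵥ y) = Z k.1 k.2 ^ 2 * y k.2 ^ 2 := by
    intro k y
    rw [hB, Matrix.smul_mulVec, Matrix.single_mulVec, smul_dotProduct, dotProduct_smul]
    simp [Function.update_apply, dotProduct]; ring
  have hBx : ∀ k x, ((B k)ᵀ *ᵥ x) ⬝ᵥ ((B k)ᵀ *ᵥ x) = Z k.1 k.2 ^ 2 * x k.1 ^ 2 := by
    intro k x
    rw [hB, Matrix.transpose_smul, Matrix.transpose_single, Matrix.smul_mulVec,
      Matrix.single_mulVec, smul_dotProduct, dotProduct_smul]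
    simp [Function.update_apply, dotProduct]; ring
  have hy : ∀ (y : n → ℝ) j, y j ^ 2 ≤ y ⬝ᵥ y := fun y j => by
    rw [sq]; exact Finset.single_le_sum (f := fun j => y j * y j)
      (fun _ _ => mul_self_nonneg _) (Finset.mem_univ j)
  have hx : ∀ (x : m → ℝ) i, x i ^ 2 ≤ x ⬝ᵥ x := fun y j => by
    rw [sq]; exact Finset.single_le_sum (f := fun j => y j * y j)
      (fun _ _ => mul_self_nonneg _) (Finset.mem_univ j)
  have hsν : 0 ≤ s * ν := by positivity
  have hmain := bernoulliProb_not_opLe_le (p := q) (L := s * ν) (V := s ^ 2 * ν) (t := q * s / 8)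
    (γ := γ) (B := B) hq0.le hq1 hsν (fun k y => ?_) (fun k x => ?_) (fun y => ?_) (fun x => ?_)
    (by positivity) hγ ?_ ?_
  · refine (bernoulliProb_mono hq0.le hq1 ?_).trans hmain
    intro ω hω hop
    refine hω ?_
    rw [hB, sum_centred_smul_single] at hop
    have h := hop.smul (inv_nonneg.2 hq0.le)
    rw [smul_sub, smul_smul, inv_mul_cancel₀ hq0.ne', one_smul] at h
    have e : q⁻¹ * (q * s / 8) = s / 8 := by field_simp
    rwa [e] at h
  · rw [hBy]; exact mul_le_mul (hZ.sq_le _ _) (hy _ _) (sq_nonneg _) (sq_nonneg _)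
  · rw [hBx]; exact mul_le_mul (hZ.sq_le _ _) (hx _ _) (sq_nonneg _) (sq_nonneg _)
  · simp only [hBy]
    rw [Fintype.sum_prod_type_right, dotProduct, Finset.mul_sum]
    refine Finset.sum_le_sum fun j _ => ?_
    dsimp only
    rw [← Finset.sum_mul, ← sq]
    exact mul_le_mul_of_nonneg_right (hZ.col j) (sq_nonneg _)
  · simp only [hBx]
    rw [Fintype.sum_prod_type, dotProduct, Finset.mul_sum]
    refine Finset.sum_le_sum fun j _ => ?_
    dsimp only
    rw [← Finset.sum_mul, ← sq]
    exact mul_le_mul_of_nonneg_right (hZ.row j) (sq_nonneg _)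
  · have := mul_le_mul_of_nonneg_left hqγ (by positivity : 0 ≤ q * s ^ 2)
    linarith
  · have := mul_le_mul_of_nonneg_left hqγ hs.le
    have h2 : 0 ≤ s * ν * γ := by positivity
    linarith

/-- Because TZ = Z, the new residual is a centred sum of independent terms, so the Bernstein bounds
apply to it. -/
lemma sub_smul_tangentProj_apply (hTZ : tangentProj P Q Z = Z) (hq : q ≠ 0) (ω : m × n → Bool)
    (i : m) (j : n) : (Z - q⁻¹ • tangentProj P Q (sampled ω Z)) i j =
      -(q⁻¹ * ∑ k : m × n, centred q ω k *
        (Z k.1 k.2 * tangentProj P Q (Matrix.single k.1 k.2 1) i j)) := by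
  rw [← tangentProj_sampled_sub_apply, hTZ]
  simp only [Matrix.sub_apply, Matrix.smul_apply, smul_eq_mul]
  field_simp
  ring

/-- The coefficients ⟨Te_ij, Te_k⟩ are at most 2ν, and their squares sum to ‖Te_ij‖² ≤ 2ν; scalar
Bernstein then halves the entry bound. -/
lemma bernoulliProb_sampled_entry (hP : IsProj P) (hQ : IsProj Q) (hPν : ∀ i, P i i ≤ ν)
    (hQν : ∀ j, Q j j ≤ ν) (hTZ : tangentProj P Q Z = Z) (hZ : IsSpread ν s Z) (hν : 0 < ν)
    (hs : 0 < s) (hq0 : 0 < q) (hq1 : q ≤ 1) (hγ : 0 ≤ γ) (hqγ : 512 * ν * γ ≤ q)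
    (i : m) (j : n) :
    bernoulliProb q {ω : m × n → Bool |
      ¬ |(Z - q⁻¹ • tangentProj P Q (sampled ω Z)) i j| ≤ s / 2 * ν} ≤ 2 * Real.exp (-γ) := by
  set c : m × n → ℝ := fun k => tangentProj P Q (Matrix.single k.1 k.2 1) i j with hc
  have hck : ∀ k, c k = frob (tangentProj P Q (Matrix.single i j 1))
      (tangentProj P Q (Matrix.single k.1 k.2 1)) := by
    intro k
    rw [← frob_tangentProj hP hQ, tangentProj_tangentProj hP hQ, frob_single, hc]
    have h1 := tangentProj_single_apply_eq_frob hP hQ (Matrix.single k.1 k.2 1) (i, j)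
    have h2 := frob_single (tangentProj P Q (Matrix.single i j 1)) k
    rw [← h2]; exact h1.symm
  have hc2 : ∀ k, c k ^ 2 ≤ (2 * ν) ^ 2 := by
    intro k
    rw [hck]
    refine (frob_sq_le _ _).trans ?_
    rw [sq]
    exact mul_le_mul (frob_tangentProj_single_self_le hP hQ hPν hQν (i, j))
      (frob_tangentProj_single_self_le hP hQ hPν hQν k) (frob_self_nonneg _) (by linarith)
  have hcs : ∑ k, c k ^ 2 ≤ 2 * ν := by
    refine le_trans (le_of_eq ?_) (frob_tangentProj_single_self_le hP hQ hPν hQν (i, j))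
    rw [frob]
    refine Finset.sum_congr rfl fun k _ => ?_
    rw [hck, ← frob_tangentProj hP hQ, tangentProj_tangentProj hP hQ, frob_single, sq]
  have hqsν : 0 < q * s * ν := by positivity
  have hmain := bernoulliProb_abs_sum_gt_le (p := q) (L := 2 * s * ν ^ 2) (V := 2 * s ^ 2 * ν ^ 3)
    (t := q * s * ν / 2) (γ := γ) (b := fun k => Z k.1 k.2 * c k) hq0.le hq1 (by positivity)
    (fun k => ?_) ?_ (by positivity) hγ ?_ ?_
  · refine (bernoulliProb_mono hq0.le hq1 ?_).trans hmain
    intro ω hω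
    simp only [Set.mem_ofPred_eq, not_le] at hω ⊢
    rw [sub_smul_tangentProj_apply hTZ hq0.ne', abs_neg, abs_mul, abs_of_pos (inv_pos.2 hq0),
      inv_mul_eq_div, lt_div_iff₀ hq0] at hω
    linarith
  · rw [mul_pow]
    refine (mul_le_mul (hZ.sq_le k.1 k.2) (hc2 k) (sq_nonneg _) (sq_nonneg _)).trans
      (le_of_eq (by ring))
  · calc ∑ k, (Z k.1 k.2 * c k) ^ 2 ≤ ∑ k, (s * ν) ^ 2 * c k ^ 2 := by
          refine Finset.sum_le_sum fun k _ => ?_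
          rw [mul_pow]
          exact mul_le_mul_of_nonneg_right (hZ.sq_le _ _) (sq_nonneg _)
      _ ≤ (s * ν) ^ 2 * (2 * ν) := by
          rw [← Finset.mul_sum]; exact mul_le_mul_of_nonneg_left hcs (sq_nonneg _)
      _ = _ := by ring
  · have := mul_le_mul_of_nonneg_left hqγ (by positivity : 0 ≤ q * s ^ 2 * ν ^ 2)
    have h2 : 0 ≤ q * s ^ 2 * ν ^ 3 * γ := by positivity
    linarith
  · have := mul_le_mul_of_nonneg_left hqγ (by positivity : 0 ≤ s * ν)
    have h2 : 0 ≤ s * ν ^ 2 * γ := by positivity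
    linarith

/-- Concentration of a row or column of the sampled tangent projection. -/
lemma bernoulliProb_sampled_line {ι : Type*} [Fintype ι] [DecidableEq ι] (f : m × n → ι → ℝ)
    (h : m × n → ℝ) (hf : ∀ k, ∑ i, f k i ^ 2 ≤ h k) (hh : ∀ k, h k ≤ 4 * ν)
    (hZh : ∑ k, Z k.1 k.2 ^ 2 * h k ≤ 4 * s ^ 2 * ν ^ 2) (hZ : IsSpread ν s Z) (hν : 0 < ν)
    (hs : 0 < s) (hq0 : 0 < q) (hq1 : q ≤ 1) (hγ : 0 ≤ γ) (hqγ : 512 * ν * γ ≤ q) :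
    bernoulliProb q {ω : m × n → Bool | ¬ ∑ i, (-(q⁻¹ * ∑ k : m × n, centred q ω k *
        (Z k.1 k.2 * f k i))) ^ 2 ≤ (s / 2) ^ 2 * ν} ≤
      (Fintype.card ι + 1) * Real.exp (-γ) := by
  have hsq : √ν ^ 2 = ν := Real.sq_sqrt hν.le
  have hsq0 : 0 < √ν := Real.sqrt_pos.2 hν
  have hdot : ∀ k, (Z k.1 k.2 • f k) ⬝ᵥ (Z k.1 k.2 • f k) ≤ Z k.1 k.2 ^ 2 * h k := by
    intro k
    rw [smul_dotProduct, dotProduct_smul, smul_eq_mul, smul_eq_mul, ← mul_assoc, ← sq]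
    refine mul_le_mul_of_nonneg_left (le_trans (le_of_eq ?_) (hf k)) (sq_nonneg _)
    exact Finset.sum_congr rfl fun i _ => (sq _).symm
  have hmain := bernoulliProb_sum_smul_gt_le (p := q) (L := 2 * s * ν * √ν)
    (V := 4 * s ^ 2 * ν ^ 2) (t := q * s * √ν / 2) (γ := γ) (v := fun k => Z k.1 k.2 • f k)
    hq0.le hq1 (by positivity) (fun k => ?_) ?_ (by positivity) hγ ?_ ?_
  · refine (bernoulliProb_mono hq0.le hq1 ?_).trans hmain
    intro ω hω
    simp only [Set.mem_ofPred_eq, not_le] at hω ⊢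
    have e : ∑ i, (-(q⁻¹ * ∑ k : m × n, centred q ω k * (Z k.1 k.2 * f k i))) ^ 2 =
        (q⁻¹) ^ 2 * ((∑ k, centred q ω k • Z k.1 k.2 • f k) ⬝ᵥ
          (∑ k, centred q ω k • Z k.1 k.2 • f k)) := by
      rw [dotProduct, Finset.mul_sum]
      refine Finset.sum_congr rfl fun i _ => ?_
      simp only [Finset.sum_apply, Pi.smul_apply, smul_eq_mul]
      ring
    rw [e, inv_pow, inv_mul_eq_div, lt_div_iff₀ (by positivity)] at hω
    calc (q * s * √ν / 2) ^ 2 = (s / 2) ^ 2 * √ν ^ 2 * q ^ 2 := by ring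
      _ < _ := by rw [hsq]; exact hω
  · refine (hdot k).trans ((mul_le_mul_of_nonneg_left (hh k) (sq_nonneg _)).trans ?_)
    refine (mul_le_mul_of_nonneg_right (hZ.sq_le k.1 k.2) (by positivity)).trans (le_of_eq ?_)
    calc (s * ν) ^ 2 * (4 * ν) = (2 * s * ν) ^ 2 * √ν ^ 2 := by rw [hsq]; ring
      _ = _ := by ring
  · exact (Finset.sum_le_sum fun k _ => hdot k).trans hZh
  · have e : (q * s * √ν / 2) ^ 2 = (q * s / 2) ^ 2 * ν := by
      calc _ = (q * s / 2) ^ 2 * √ν ^ 2 := by ring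
        _ = _ := by rw [hsq]
    rw [e]
    have := mul_le_mul_of_nonneg_left hqγ (by positivity : 0 ≤ q * s ^ 2 * ν)
    have h2 : 0 ≤ q * s ^ 2 * ν ^ 2 * γ := by positivity
    linarith
  · have := mul_le_mul_of_nonneg_left hqγ (by positivity : 0 ≤ s * √ν)
    have h2 : 0 ≤ s * ν * √ν * γ := by positivity
    linarith

lemma sum_two_mul_ite_add_le (hQ : IsProj Q) (hQν : ∀ j, Q j j ≤ ν) (j : n) :
    ∑ b, (2 * (if b = j then ν else 0) + 2 * Q b j ^ 2) ≤ 4 * ν := by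
  rw [Finset.sum_add_distrib, ← Finset.mul_sum, ← Finset.mul_sum, hQ.sum_sq_apply]
  simp only [Finset.sum_ite_eq', Finset.mem_univ, if_true]
  linarith [hQν j]

lemma bernoulliProb_sampled_col (hP : IsProj P) (hQ : IsProj Q) (hPν : ∀ i, P i i ≤ ν)
    (hQν : ∀ j, Q j j ≤ ν) (hTZ : tangentProj P Q Z = Z) (hZ : IsSpread ν s Z) (hν : 0 < ν)
    (hs : 0 < s) (hq0 : 0 < q) (hq1 : q ≤ 1) (hγ : 0 ≤ γ) (hqγ : 512 * ν * γ ≤ q) (j : n) :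
    bernoulliProb q {ω : m × n → Bool | ¬
      ∑ i, (Z - q⁻¹ • tangentProj P Q (sampled ω Z)) i j ^ 2 ≤ (s / 2) ^ 2 * ν} ≤
      (Fintype.card m + 1) * Real.exp (-γ) := by
  simp only [sub_smul_tangentProj_apply hTZ hq0.ne']
  -- The weight depends only on the column b, so the variance ∑ Z²h factors through the column norms
  -- of Z, at most s²ν, times ∑ h ≤ 4ν. The full Frobenius norm of Z never enters.
  set h : n → ℝ := fun b => 2 * (if b = j then ν else 0) + 2 * Q b j ^ 2 with hh
  have h0 : ∀ b, 0 ≤ h b := fun b => by simp only [hh]; split_ifs <;> positivity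
  have hsum : ∑ b, h b ≤ 4 * ν := sum_two_mul_ite_add_le hQ hQν j
  refine bernoulliProb_sampled_line
    (fun k i => tangentProj P Q (Matrix.single k.1 k.2 1) i j) (fun k => h k.2)
    (fun k => sum_col_sq_tangentProj_single_le hP hPν k j)
    (fun k => (Finset.single_le_sum (fun b _ => h0 b) (Finset.mem_univ k.2)).trans hsum)
    ?_ hZ hν hs hq0 hq1 hγ hqγ
  rw [Fintype.sum_prod_type_right]
  calc ∑ b, ∑ a, Z a b ^ 2 * h b ≤ ∑ b, s ^ 2 * ν * h b := by
        refine Finset.sum_le_sum fun b _ => ?_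
        rw [← Finset.sum_mul]
        exact mul_le_mul_of_nonneg_right (hZ.col b) (h0 b)
    _ ≤ s ^ 2 * ν * (4 * ν) := by
        rw [← Finset.mul_sum]; exact mul_le_mul_of_nonneg_left hsum (by positivity)
    _ = _ := by ring

lemma bernoulliProb_sampled_row (hP : IsProj P) (hQ : IsProj Q) (hPν : ∀ i, P i i ≤ ν)
    (hQν : ∀ j, Q j j ≤ ν) (hTZ : tangentProj P Q Z = Z) (hZ : IsSpread ν s Z) (hν : 0 < ν)
    (hs : 0 < s) (hq0 : 0 < q) (hq1 : q ≤ 1) (hγ : 0 ≤ γ) (hqγ : 512 * ν * γ ≤ q) (i : m) :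
    bernoulliProb q {ω : m × n → Bool | ¬
      ∑ j, (Z - q⁻¹ • tangentProj P Q (sampled ω Z)) i j ^ 2 ≤ (s / 2) ^ 2 * ν} ≤
      (Fintype.card n + 1) * Real.exp (-γ) := by
  simp only [sub_smul_tangentProj_apply hTZ hq0.ne']
  set h : m → ℝ := fun b => 2 * (if b = i then ν else 0) + 2 * P b i ^ 2 with hh
  have h0 : ∀ b, 0 ≤ h b := fun b => by simp only [hh]; split_ifs <;> positivity
  have hsum : ∑ b, h b ≤ 4 * ν := sum_two_mul_ite_add_le hP hPν i
  refine bernoulliProb_sampled_line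
    (fun k j => tangentProj P Q (Matrix.single k.1 k.2 1) i j) (fun k => h k.1)
    (fun k => sum_row_sq_tangentProj_single_le hP hQ hQν k i)
    (fun k => (Finset.single_le_sum (fun b _ => h0 b) (Finset.mem_univ k.1)).trans hsum)
    ?_ hZ hν hs hq0 hq1 hγ hqγ
  rw [Fintype.sum_prod_type]
  calc ∑ a, ∑ b, Z a b ^ 2 * h a ≤ ∑ a, s ^ 2 * ν * h a := by
        refine Finset.sum_le_sum fun a _ => ?_
        rw [← Finset.sum_mul]
        exact mul_le_mul_of_nonneg_right (hZ.row a) (h0 a)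
    _ ≤ s ^ 2 * ν * (4 * ν) := by
        rw [← Finset.mul_sum]; exact mul_le_mul_of_nonneg_left hsum (by positivity)
    _ = _ := by ring

/-- One step of the golfing scheme. -/
lemma bernoulliProb_golfing_step (hP : IsProj P) (hQ : IsProj Q) (hPν : ∀ i, P i i ≤ ν)
    (hQν : ∀ j, Q j j ≤ ν) (hTZ : tangentProj P Q Z = Z) (hZ : IsSpread ν s Z) (hν : 0 < ν)
    (hs : 0 < s) (hq0 : 0 < q) (hq1 : q ≤ 1) (hγ : 0 ≤ γ) (hqγ : 512 * ν * γ ≤ q) :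
    bernoulliProb q {ω : m × n → Bool | ¬
      (IsSpread ν (s / 2) (Z - q⁻¹ • tangentProj P Q (sampled ω Z)) ∧
        OpLe (q⁻¹ • sampled ω Z - Z) (s / 8))} ≤
      6 * (Fintype.card m + Fintype.card n) ^ 2 * Real.exp (-γ) := by
  have hE := bernoulliProb_iUnion_le hq0.le hq1 (τ := m × n) _ fun k =>
    bernoulliProb_sampled_entry hP hQ hPν hQν hTZ hZ hν hs hq0 hq1 hγ hqγ k.1 k.2
  have hC := bernoulliProb_iUnion_le hq0.le hq1 _ fun j =>
    bernoulliProb_sampled_col hP hQ hPν hQν hTZ hZ hν hs hq0 hq1 hγ hqγ j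
  have hR := bernoulliProb_iUnion_le hq0.le hq1 _ fun i =>
    bernoulliProb_sampled_row hP hQ hPν hQν hTZ hZ hν hs hq0 hq1 hγ hqγ i
  have hO := bernoulliProb_sampled_opLe hZ hν.le hs hq0 hq1 hγ hqγ
  refine (bernoulliProb_mono hq0.le hq1 ?_).trans ((bernoulliProb_union_le hq0.le hq1 _ _).trans
    ((add_le_add ((bernoulliProb_union_le hq0.le hq1 _ _).trans
      (add_le_add ((bernoulliProb_union_le hq0.le hq1 _ _).trans (add_le_add hE hC)) hR)) hO).trans
      ?_))
  · intro ω hω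
    by_contra hcon
    simp only [Set.mem_union, Set.mem_iUnion, Set.mem_ofPred_eq, not_or, not_exists,
      not_not] at hcon hω
    exact hω ⟨⟨fun i j => hcon.1.1.1 (i, j), hcon.1.2, hcon.1.1.2⟩, hcon.2⟩
  · have he := Real.exp_pos (-γ)
    rw [Fintype.card_prod]
    push_cast
    set a : ℝ := ((Fintype.card m : ℕ) : ℝ) with ha
    set b : ℝ := ((Fintype.card n : ℕ) : ℝ) with hb
    have key : a * b * 2 + b * (a + 1) + a * (b + 1) + (a + b) ≤ 6 * (a + b) ^ 2 := by
      have h1 : a ≤ a ^ 2 := by rw [ha]; exact_mod_cast Nat.le_self_pow two_ne_zero _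
      have h2 : b ≤ b ^ 2 := by rw [hb]; exact_mod_cast Nat.le_self_pow two_ne_zero _
      have h3 : 0 ≤ a * b := by positivity
      nlinarith
    nlinarith [mul_le_mul_of_nonneg_right key he.le]

end Sampling

/-! ### The golfing scheme -/

section Golfing

variable {m n : Type*} [Fintype m] [Fintype n] [DecidableEq m] [DecidableEq n]

/-- `Z` has an approximate dual certificate supported on the sampled entries. -/
def HasCertificate (P : Matrix m m ℝ) (Q : Matrix n n ℝ) (c e : ℝ) (Z : Matrix m n ℝ)
    (ω : m × n → Bool) : Prop :=
  ∃ Y : Matrix m n ℝ, (∀ k, ω k = false → Y k.1 k.2 = 0) ∧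
    (∀ i j, |(tangentProj P Q Y - Z) i j| ≤ e) ∧ OpLe (normalProj P Q Y) c

variable {P : Matrix m m ℝ} {Q : Matrix n n ℝ} {ν q γ : ℝ}

/-- A certificate for the residual is corrected by the rescaled sample of Z. Since NZ = 0, that
sample has the same normal part as its deviation from Z, so the spectral bounds add: s/8 + s/8 =
s/4. -/
lemma HasCertificate.of_step (hP : IsProj P) (hQ : IsProj Q) {Z : Matrix m n ℝ}
    (hTZ : tangentProj P Q Z = Z) {s e : ℝ} (hs : 0 ≤ s) {ω₁ ω₂ : m × n → Bool}
    (h₁ : OpLe (q⁻¹ • sampled ω₁ Z - Z) (s / 8))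
    (h₂ : HasCertificate P Q (s / 8) e (Z - q⁻¹ • tangentProj P Q (sampled ω₁ Z)) ω₂) :
    HasCertificate P Q (s / 4) e Z (fun k => ω₁ k || ω₂ k) := by
  obtain ⟨Y, hY, hYe, hYc⟩ := h₂
  refine ⟨Y + q⁻¹ • sampled ω₁ Z, fun k hk => ?_, fun i j => ?_, ?_⟩
  · rw [Bool.or_eq_false_iff] at hk
    simp [hY k hk.2, sampled, hk.1]
  · have : tangentProj P Q (Y + q⁻¹ • sampled ω₁ Z) - Z =
        tangentProj P Q Y - (Z - q⁻¹ • tangentProj P Q (sampled ω₁ Z)) := by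
      rw [map_add, map_smul]; abel
    rw [this]; exact hYe i j
  · have h3 := h₁.normalProj hP hQ (by positivity)
    rw [map_sub, normalProj_eq_zero hTZ, sub_zero] at h3
    have h4 := hYc.add h3
    rw [← map_add] at h4
    convert! h4 using 1
    ring

/-- Induction peels off one independent sample, for all Z and s at once: given the first sample, the
residual is a fixed matrix of spread s/2, so the hypothesis applies to the remaining rounds.
Failures add up by the union bound. -/
lemma bernoulliProb_not_hasCertificate (hP : IsProj P) (hQ : IsProj Q) (hPν : ∀ i, P i i ≤ ν)
    (hQν : ∀ j, Q j j ≤ ν) (hν : 0 < ν) (hq0 : 0 < q) (hq1 : q ≤ 1) (hγ : 0 ≤ γ)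
    (hqγ : 512 * ν * γ ≤ q) (N : ℕ) :
    ∀ (s : ℝ), 0 < s → ∀ Z : Matrix m n ℝ, tangentProj P Q Z = Z → IsSpread ν s Z →
    bernoulliProb (1 - (1 - q) ^ N)
      {ω | ¬ HasCertificate P Q (s / 4) (s * (1 / 2) ^ N * ν) Z ω} ≤
      N * (6 * (Fintype.card m + Fintype.card n) ^ 2 * Real.exp (-γ)) := by
  induction N with
  | zero =>
    intro s hs Z _ hZ
    have : {ω | ¬ HasCertificate P Q (s / 4) (s * (1 / 2) ^ 0 * ν) Z ω} = ∅ := by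
      rw [Set.eq_empty_iff_forall_notMem]
      intro ω hω
      refine hω ⟨0, by simp, fun i j => ?_, fun x y => ?_⟩
      · simpa using hZ.entry i j
      · have h1 := dotProduct_self_nonneg' x
        have h2 := dotProduct_self_nonneg' y
        simp only [map_zero, Matrix.zero_mulVec, dotProduct_zero, mul_zero]
        positivity
    rw [this, bernoulliProb_empty]; simp
  | succ N ih =>
    intro s hs Z hTZ hZ
    have hr0 : 0 ≤ 1 - (1 - q) ^ N := sub_nonneg.2 (pow_le_one₀ (by linarith) (by linarith))
    have hr1 : 1 - (1 - q) ^ N ≤ 1 := by linarith [pow_nonneg (sub_nonneg.2 hq1) N]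
    have e : 1 - (1 - q) ^ (N + 1) = 1 - (1 - q) * (1 - (1 - (1 - q) ^ N)) := by ring
    rw [e, bernoulliProb_or]
    set ε := 6 * ((Fintype.card m : ℝ) + Fintype.card n) ^ 2 * Real.exp (-γ) with hε
    have hstep := bernoulliProb_golfing_step hP hQ hPν hQν hTZ hZ hν hs hq0 hq1 hγ hqγ
    set G : Set (m × n → Bool) := {ω | ¬
      (IsSpread ν (s / 2) (Z - q⁻¹ • tangentProj P Q (sampled ω Z)) ∧
        OpLe (q⁻¹ • sampled ω Z - Z) (s / 8))} with hG
    have hpt : ∀ ω₁ : m × n → Bool, bernoulliProb (1 - (1 - q) ^ N) {ω₂ : m × n → Bool |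
        (fun k => ω₁ k || ω₂ k) ∈
          {ω | ¬ HasCertificate P Q (s / 4) (s * (1 / 2) ^ (N + 1) * ν) Z ω}} ≤
        G.indicator 1 ω₁ + N * ε := by
      intro ω₁
      have hNε : 0 ≤ N * ε := by positivity
      by_cases hω : ω₁ ∈ G
      · rw [Set.indicator_of_mem hω]
        exact (bernoulliProb_le_one hr0 hr1 _).trans (by simpa using hNε)
      · rw [Set.indicator_of_notMem hω, zero_add]
        simp only [hG, Set.mem_ofPred_eq, not_not] at hω
        refine (bernoulliProb_mono hr0 hr1 ?_).trans (ih (s / 2) (by linarith)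
          (Z - q⁻¹ • tangentProj P Q (sampled ω₁ Z)) ?_ hω.1)
        · intro ω₂ h hc
          refine h (HasCertificate.of_step hP hQ hTZ hs.le hω.2 ?_)
          convert! hc using 1
          · ring
          · ring
        · rw [map_sub, map_smul, tangentProj_tangentProj hP hQ, hTZ]
    calc _ ≤ ∑ ω₁ : m × n → Bool, bernoulliWeight q ω₁ * (G.indicator 1 ω₁ + N * ε) :=
          Finset.sum_le_sum fun ω₁ _ =>
            mul_le_mul_of_nonneg_left (hpt ω₁) (bernoulliWeight_nonneg hq0.le hq1 ω₁)
      _ = bernoulliProb q G + N * ε := by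
          simp only [mul_add, Finset.sum_add_distrib, ← Finset.sum_mul]
          rw [sum_bernoulliWeight, one_mul, bernoulliProb]
      _ ≤ ε + N * ε := by linarith
      _ = _ := by push_cast; ring

end Golfing

/-! ### Incoherence and transfer to an arbitrary probability space -/

section Main

variable {n₁ n₂ r : ℕ}

lemma norm_sq_transpose_mulVec_single {m : Type*} [Fintype m] [DecidableEq m]
    (U : Matrix m (Fin r) ℝ) (i : m) :
    ‖WithLp.toLp 2 (Uᵀ *ᵥ Pi.single i 1)‖ ^ 2 = (U * Uᵀ) i i := by
  rw [norm_sq_toLp, mulVec_dotProduct_mulVec, Matrix.transpose_transpose,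
    single_one_dotProduct, Matrix.mulVec_single_one]
  rfl

lemma mul_transpose_apply_sq_le {m n : Type*} [Fintype m] [Fintype n]
    (U : Matrix m (Fin r) ℝ) (V : Matrix n (Fin r) ℝ) (i : m) (j : n) :
    (U * Vᵀ) i j ^ 2 ≤ (U * Uᵀ) i i * (V * Vᵀ) j j :=
  dotProduct_sq_le (U i) (V j)

lemma sum_row_sq_mul_transpose {m n : Type*} [Fintype m] [Fintype n]
    (U : Matrix m (Fin r) ℝ) {V : Matrix n (Fin r) ℝ} (hV : Vᵀ * V = 1) (i : m) :
    ∑ j, (U * Vᵀ) i j ^ 2 = (U * Uᵀ) i i := by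
  have : U * Uᵀ = (U * Vᵀ) * (U * Vᵀ)ᵀ := by
    rw [Matrix.transpose_mul, Matrix.transpose_transpose, Matrix.mul_assoc, ← Matrix.mul_assoc Vᵀ,
      hV, Matrix.one_mul]
  rw [this, Matrix.mul_apply]
  exact Finset.sum_congr rfl fun j _ => sq _

/-- Entries are inner products of rows of U and V, of squared length at most ν, so Cauchy–Schwarz
suffices; squared row and column norms are the diagonals of UUᵀ and VVᵀ. This starts the golfing at
s = 1. -/
lemma isSpread_mul_transpose {m n : Type*} [Fintype m] [Fintype n] {U : Matrix m (Fin r) ℝ}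
    {V : Matrix n (Fin r) ℝ} (hU : Uᵀ * U = 1) (hV : Vᵀ * V = 1) {ν : ℝ} (hν : 0 ≤ ν)
    (hPν : ∀ i, (U * Uᵀ) i i ≤ ν) (hQν : ∀ j, (V * Vᵀ) j j ≤ ν) : IsSpread ν 1 (U * Vᵀ) where
  entry i j := by
    rw [one_mul]
    refine abs_le_of_sq_le_sq ((mul_transpose_apply_sq_le U V i j).trans ?_) hν
    rw [sq]
    exact mul_le_mul (hPν i) (hQν j) ((isProj_mul_transpose hV).apply_self_nonneg j) hν
  row i := by rw [sum_row_sq_mul_transpose U hV]; simpa using hPν i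
  col j := by
    have h := sum_row_sq_mul_transpose V hU j
    rw [one_pow, one_mul]
    refine le_trans (le_of_eq ?_) (hQν j)
    rw [← h]
    refine Finset.sum_congr rfl fun i _ => ?_
    rw [← Matrix.transpose_apply (U * Vᵀ), Matrix.transpose_mul, Matrix.transpose_transpose]

/-- The event is covered by the finitely many sampling patterns satisfying G, each of probability
`bernoulliWeight`. An inequality suffices and needs no measurability of the event itself. -/
lemma measureReal_le_bernoulliProb {S : Type*} [MeasurableSpace S] {P : Measure S}
    [IsProbabilityMeasure P] {Ω : S → Set (Fin n₁ × Fin n₂)} {p : ℝ}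
    (h : IsBernoulliSampling P Ω p) (G : Set (Fin n₁ × Fin n₂) → Prop) :
    P.real {s | G (Ω s)} ≤ bernoulliProb p {ω : Fin n₁ × Fin n₂ → Bool | G {k | ω k = true}} := by
  classical
  set A : (Fin n₁ × Fin n₂ → Bool) → Set S := fun ω =>
    ⋂ k ∈ Finset.univ, if ω k then {s | k ∈ Ω s} else {s | k ∈ Ω s}ᶜ with hA
  have hAP : ∀ ω, P.real (A ω) = bernoulliWeight p ω := by
    intro ω
    have h1 := (iIndepSet_iff _ P).1 h.indep Finset.univ
      (f := fun k => if ω k then {s | k ∈ Ω s} else {s | k ∈ Ω s}ᶜ) (by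
        intro k _
        have hm : MeasurableSet[MeasurableSpace.generateFrom {{s | k ∈ Ω s}}] {s | k ∈ Ω s} :=
          MeasurableSpace.measurableSet_generateFrom rfl
        split_ifs
        · exact hm
        · exact hm.compl)
    rw [hA, Measure.real, h1, ENNReal.toReal_prod, bernoulliWeight]
    refine Finset.prod_congr rfl fun k _ => ?_
    change P.real _ = _
    split_ifs
    · exact h.prob k
    · rw [probReal_compl_eq_one_sub (h.measurable k), h.prob k]
  have hsub : {s | G (Ω s)} ⊆ ⋃ ω ∈ Finset.univ.filter
      (fun ω : Fin n₁ × Fin n₂ → Bool => G {k | ω k = true}), A ω := by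
    intro s hs
    simp only [Set.mem_iUnion]
    refine ⟨fun k => decide (k ∈ Ω s), ?_, ?_⟩
    · simpa using hs
    · simp only [hA, Set.mem_iInter]
      intro k _
      by_cases hk : k ∈ Ω s <;> simp [hk]
  refine (measureReal_mono hsub (measure_ne_top _ _)).trans ((measureReal_biUnion_finset_le _ _).trans ?_)
  simp only [hAP]
  rw [Finset.sum_filter, bernoulliProb]
  refine Finset.sum_le_sum fun ω _ => ?_
  by_cases hω : G {k | ω k = true}
  · rw [if_pos hω, Set.indicator_of_mem (by exact hω)]; simp
  · rw [if_neg hω, Set.indicator_of_notMem (by exact hω)]; simp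

/-- The failure probability under Bernoulli sampling, for `N` golfing steps. -/
lemma bernoulliProb_not_isUniqueOptimal {M : Matrix (Fin n₁) (Fin n₂) ℝ}
    {U : Matrix (Fin n₁) (Fin r) ℝ} {σ : Fin r → ℝ} {V : Matrix (Fin n₂) (Fin r) ℝ}
    (h : IsCompactSVD M U σ V) {ν p γ : ℝ} (hν : 0 < ν) (hPν : ∀ i, (U * Uᵀ) i i ≤ ν)
    (hQν : ∀ j, (V * Vᵀ) j j ≤ ν) (hp1 : p ≤ 1) (hνp : ν ≤ p) (hγ : 0 ≤ γ) {N : ℕ} (hN : 0 < N)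
    (hpγ : 512 * ν * γ * N ≤ p) (hNd : 4 * ((n₁ : ℝ) + n₂) ≤ 2 ^ N) :
    bernoulliProb p {ω : Fin n₁ × Fin n₂ → Bool | ¬ IsUniqueOptimal M {k | ω k = true} M} ≤
      8 * N * ((n₁ : ℝ) + n₂) ^ 2 * Real.exp (-γ) := by
  have hP := isProj_mul_transpose h.left_orthonormal
  have hQ := isProj_mul_transpose h.right_orthonormal
  have hp0 : 0 < p := hν.trans_le hνp
  have hN1 : (1 : ℝ) ≤ N := by exact_mod_cast hN
  have hN0 : (N : ℝ) ≠ 0 := by positivity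
  -- The density at which N independent rounds have a union of density exactly p; Bernoulli's
  -- inequality gives q ≥ p/N.
  set q : ℝ := 1 - (1 - p) ^ (1 / N : ℝ) with hq
  have hqN : 1 - (1 - q) ^ N = p := by
    have : (1 - q) = (1 - p) ^ (1 / N : ℝ) := by rw [hq]; ring
    rw [this, ← Real.rpow_natCast, ← Real.rpow_mul (by linarith), one_div_mul_cancel hN0,
      Real.rpow_one]
    ring
  have hq1 : q ≤ 1 := by
    have : 0 ≤ (1 - p) ^ (1 / N : ℝ) := Real.rpow_nonneg (by linarith) _
    linarith
  have hqp : p / N ≤ q := by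
    have h1 : 1 + N * (-(p / N)) ≤ (1 + -(p / N)) ^ N := by
      refine one_add_mul_le_pow ?_ N
      have : p / N ≤ 1 := (div_le_one (by positivity)).2 (hp1.trans hN1)
      linarith
    have h2 : (1 - q) ^ N ≤ (1 + -(p / N)) ^ N := by
      have : 1 + N * (-(p / N)) = 1 - p := by field_simp; ring
      linarith
    have h3 := le_of_pow_le_pow_left₀ hN.ne' (by
      have : p / N ≤ 1 := (div_le_one (by positivity)).2 (hp1.trans hN1)
      linarith) h2
    linarith
  have hq0 : 0 < q := lt_of_lt_of_le (by positivity) hqp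
  have hqγ : 512 * ν * γ ≤ q := le_trans ((le_div_iff₀ (by positivity)).2 hpγ) hqp
  have hpγ' : 64 * ν * γ ≤ p := by
    have h1 : 0 ≤ ν * γ := by positivity
    nlinarith [mul_le_mul_of_nonneg_left hN1 h1]
  have hTUV : tangentProj (U * Uᵀ) (V * Vᵀ) (U * Vᵀ) = U * Vᵀ := by
    have := tangentProj_mul_mul (V := V) h.left_orthonormal 1
    rwa [Matrix.mul_one] at this
  have hcert := bernoulliProb_not_hasCertificate hP hQ hPν hQν hν hq0 hq1 hγ hqγ N 1 one_pos
    (U * Vᵀ) hTUV (isSpread_mul_transpose h.left_orthonormal h.right_orthonormal hν.le hPν hQν)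
  rw [hqN] at hcert
  have hinj := bernoulliProb_not_injective_le hP hQ hν.le hPν hQν hp0 hp1 hγ hpγ'
  refine (bernoulliProb_mono hp0.le hp1 ?_).trans ((bernoulliProb_union_le hp0.le hp1 _ _).trans
    ((add_le_add hcert hinj).trans ?_))
  · intro ω hω
    by_contra hcon
    simp only [Set.mem_union, Set.mem_ofPred_eq, not_or, not_not] at hcon
    obtain ⟨⟨Y, hY, hYe, hYc⟩, hA⟩ := hcon
    set ε : ℝ := ((n₁ : ℝ) + n₂) * (1 * (1 / 2) ^ N * ν) with hε
    refine hω (isUniqueOptimal_of_certificate h (Ω := {k | ω k = true}) (a := p / 2) (ε := ε)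
      (by linarith) ?_ Y ?_ hYc ?_ ?_)
    -- N rounds shrink the entrywise error to 2^{-N}ν, and the factor n₁ + n₂ converts it to a
    -- Frobenius bound. With ν ≤ p ≤ 1 this gives 4ε² ≤ ν²/4 ≤ p/2.
    · have h1 : ε ≤ ν / 4 := by
        have h2 : ((n₁ : ℝ) + n₂) * (1 / 2) ^ N ≤ 1 / 4 := by
          rw [one_div, inv_pow, ← div_eq_mul_inv, div_le_iff₀ (by positivity)]
          linarith
        rw [hε]; nlinarith
      have h0 : 0 ≤ ε := by positivity
      have h3 : ε ^ 2 ≤ (ν / 4) ^ 2 := pow_le_pow_left₀ h0 h1 2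
      nlinarith
    · intro k hk
      exact hY k (by simpa using hk)
    · have h1 : ∀ k : Fin n₁ × Fin n₂, (tangentProj (U * Uᵀ) (V * Vᵀ) Y - U * Vᵀ) k.1 k.2 *
          (tangentProj (U * Uᵀ) (V * Vᵀ) Y - U * Vᵀ) k.1 k.2 ≤ (1 * (1 / 2) ^ N * ν) ^ 2 := by
        intro k
        rw [← sq, ← sq_abs]
        exact pow_le_pow_left₀ (abs_nonneg _) (hYe k.1 k.2) 2
      rw [frob]
      refine (Finset.sum_le_sum fun k _ => h1 k).trans ?_
      rw [Finset.sum_const, Finset.card_univ, Fintype.card_prod, Fintype.card_fin,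
        Fintype.card_fin, nsmul_eq_mul, hε, mul_pow ((n₁ : ℝ) + n₂)]
      refine mul_le_mul_of_nonneg_right ?_ (sq_nonneg _)
      push_cast
      have h2 : (0 : ℝ) ≤ n₁ * n₂ := by positivity
      nlinarith [sq_nonneg (n₁ : ℝ), sq_nonneg (n₂ : ℝ)]
    · intro H
      refine (hA H).trans (le_of_eq (Finset.sum_congr rfl fun k _ => ?_))
      simp [Set.indicator]
  · have he := Real.exp_pos (-γ)
    simp only [Fintype.card_prod, Fintype.card_fin]
    push_cast
    have h1 : (0 : ℝ) ≤ n₁ * n₂ := by positivity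
    have h2 : 2 * ((n₁ : ℝ) * n₂) ≤ 2 * N * ((n₁ : ℝ) + n₂) ^ 2 := by
      have : ((n₁ : ℝ) * n₂) ≤ ((n₁ : ℝ) + n₂) ^ 2 := by
        nlinarith [sq_nonneg (n₁ : ℝ), sq_nonneg (n₂ : ℝ)]
      nlinarith
    nlinarith [mul_le_mul_of_nonneg_right h2 he.le]

lemma pos_of_incoherence {U : Matrix (Fin n₁) (Fin r) ℝ} (hU : Uᵀ * U = 1) (hr : 0 < r) {ν : ℝ}
    (hPν : ∀ i, (U * Uᵀ) i i ≤ ν) : 0 < ν := by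
  have htr : (U * Uᵀ).trace = r := by
    rw [Matrix.trace_mul_comm, hU]; simp
  by_contra hneg
  have : (U * Uᵀ).trace ≤ 0 := by
    rw [Matrix.trace]
    exact Finset.sum_nonpos fun i _ => (hPν i).trans (not_lt.1 hneg)
  rw [htr] at this
  have : (0 : ℝ) < r := by exact_mod_cast hr
  linarith

lemma mul_transpose_apply_self_le {m : ℕ} {U : Matrix (Fin m) (Fin r) ℝ} (hU : Uᵀ * U = 1)
    (hr : 0 < r) {μ k : ℝ} (hk : 0 < k) (hkm : k ≤ m)
    (h : ∀ i, ‖WithLp.toLp 2 (Uᵀ *ᵥ Pi.single i 1)‖ ≤ √(μ * r / m)) (i : Fin m) :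
    (U * Uᵀ) i i ≤ μ * r / k := by
  have hm : (0 : ℝ) < m := hk.trans_le hkm
  -- The sign of μ is not assumed, and the square root of a negative real is 0; hence the maximum.
  -- Positivity follows because UUᵀ has trace r > 0.
  have hmax : ∀ i, (U * Uᵀ) i i ≤ max 0 (μ * r / m) := by
    intro i
    rw [← norm_sq_transpose_mulVec_single, max_comm, ← Real.sq_sqrt (le_max_right _ _)]
    exact pow_le_pow_left₀ (norm_nonneg _)
      ((h i).trans (Real.sqrt_le_sqrt (le_max_left _ _))) 2
  have hpos : 0 < μ * r / m := by
    have := pos_of_incoherence hU hr hmax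
    rcases lt_max_iff.1 this with h | h
    · exact absurd h (lt_irrefl _)
    · exact h
  have h1 := hmax i
  rw [max_eq_right hpos.le] at h1
  refine h1.trans ?_
  have : 0 < μ * r := by
    have := mul_pos hpos hm
    rwa [div_mul_cancel₀ _ hm.ne'] at this
  exact div_le_div_of_nonneg_left this.le hk hkm

/-- Take N = ⌈log₂(4d)⌉. As d ≥ 2, log(4d) ≤ 3 log d, so the quotient by log 2 is at most 6 log d,
and 2 log d absorbs the rounding. -/
lemma exists_golfing_steps {d : ℝ} (hd : 2 ≤ d) :
    ∃ N : ℕ, 0 < N ∧ 4 * d ≤ 2 ^ N ∧ (N : ℝ) ≤ 8 * Real.log d := by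
  have hlog2 : 0.69 < Real.log 2 := by linarith [Real.log_two_gt_d9]
  have hlogd : Real.log 2 ≤ Real.log d := Real.log_le_log (by norm_num) hd
  set N := ⌈Real.log (4 * d) / Real.log 2⌉₊ with hN
  have h4 : Real.log (4 * d) = 2 * Real.log 2 + Real.log d := by
    rw [Real.log_mul (by norm_num) (by linarith)]
    have : (4 : ℝ) = 2 ^ 2 := by norm_num
    rw [this, Real.log_pow]; norm_num
  have hpos : 0 < Real.log (4 * d) / Real.log 2 := by
    rw [h4]; exact div_pos (by linarith) (by linarith)
  refine ⟨N, Nat.ceil_pos.2 hpos, ?_, ?_⟩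
  · have h1 := Nat.le_ceil (Real.log (4 * d) / Real.log 2)
    rw [div_le_iff₀ (by linarith)] at h1
    have h2 : Real.log (4 * d) ≤ Real.log (2 ^ N) := by rw [Real.log_pow]; exact h1
    exact (Real.log_le_log_iff (by linarith) (by positivity)).1 h2
  · have h1 := (Nat.ceil_lt_add_one hpos.le).le
    have h2 : Real.log (4 * d) / Real.log 2 ≤ 6 * Real.log d := by
      rw [div_le_iff₀ (by linarith), h4]
      nlinarith
    rw [← hN] at h1
    linarith

lemma isUniqueOptimal_of_isCompactSVD_zero {M : Matrix (Fin n₁) (Fin n₂) ℝ}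
    {U : Matrix (Fin n₁) (Fin 0) ℝ} {σ : Fin 0 → ℝ} {V : Matrix (Fin n₂) (Fin 0) ℝ}
    (h : IsCompactSVD M U σ V) (Ω : Set (Fin n₁ × Fin n₂)) : IsUniqueOptimal M Ω M := by
  have hM : M = 0 := by
    rw [h.eq]; ext i j; simp [Matrix.mul_apply]
  rw [hM]; exact isUniqueOptimal_of_rank_zero Ω

end Main

end MatrixCompletion

/-! ### The recovery theorem with explicit constants. -/

open MatrixCompletion in
theorem theorem1 :
    ∃ c₀ c₁ c₂ : ℝ, 0 < c₀ ∧ 0 < c₁ ∧ 0 < c₂ ∧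
      ∀ (n₁ n₂ : ℕ), 0 < n₁ → 0 < n₂ →
      ∀ (r : ℕ) (M : Matrix (Fin n₁) (Fin n₂) ℝ) (μ₀ : ℝ), M.rank = r →
        MatrixCompletion.StandardIncoherence M r μ₀ →
      ∀ (S : Type*) (_ : MeasurableSpace S) (P : Measure S) (_ : IsProbabilityMeasure P)
        (Ω : S → Set (Fin n₁ × Fin n₂)) (p : ℝ),
        MatrixCompletion.IsBernoulliSampling P Ω p →
        c₀ * (μ₀ * r * Real.log ((n₁ : ℝ) + n₂) ^ 2 / min (n₁ : ℝ) n₂) ≤ p →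
        1 - c₁ * ((n₁ : ℝ) + n₂) ^ (-c₂) ≤
          P.real {s | MatrixCompletion.IsUniqueOptimal M (Ω s) M} := by
  -- 16384 = 512 · 4 · 8: the golfing condition 512νγN ≤ p with γ = 4 log d and N ≤ 8 log d.
  refine ⟨16384, 64, 1, by norm_num, by norm_num, one_pos, ?_⟩
  intro n₁ n₂ h₁ h₂ r M μ₀ _ hinc S _ P _ Ω p hΩ hp
  obtain ⟨U, σ, V, hsvd, hU, hV⟩ := hinc
  have hn₁ : (1 : ℝ) ≤ n₁ := by exact_mod_cast h₁
  have hn₂ : (1 : ℝ) ≤ n₂ := by exact_mod_cast h₂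
  have hd0 : (0 : ℝ) ≤ 64 * ((n₁ : ℝ) + n₂) ^ (-1 : ℝ) := by positivity
  rcases Nat.eq_zero_or_pos r with rfl | hr
  · have : {s | IsUniqueOptimal M (Ω s) M} = Set.univ :=
      Set.eq_univ_of_forall fun s => isUniqueOptimal_of_isCompactSVD_zero hsvd (Ω s)
    rw [this, probReal_univ]
    linarith
  set d : ℝ := (n₁ : ℝ) + n₂ with hd
  have hd2 : 2 ≤ d := by linarith
  set k : ℝ := min (n₁ : ℝ) n₂ with hk
  have hk0 : 0 < k := lt_min (by linarith) (by linarith)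
  set ν : ℝ := μ₀ * r / k with hνdef
  have hPν := mul_transpose_apply_self_le hsvd.left_orthonormal hr hk0 (min_le_left _ _) hU
  have hQν := mul_transpose_apply_self_le hsvd.right_orthonormal hr hk0 (min_le_right _ _) hV
  have hν : 0 < ν := pos_of_incoherence hsvd.left_orthonormal hr hPν
  have hp1 : p ≤ 1 := by
    rw [← hΩ.prob (⟨0, h₁⟩, ⟨0, h₂⟩)]; exact measureReal_le_one
  obtain ⟨N, hN0, hNd, hN⟩ := exists_golfing_steps hd2
  have hlog : 0.69 < Real.log d := by
    have := Real.log_le_log (by norm_num) hd2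
    linarith [Real.log_two_gt_d9]
  have hp' : 16384 * ν * Real.log d ^ 2 ≤ p := by
    refine le_trans (le_of_eq ?_) hp
    rw [hνdef]; ring
  have hνp : ν ≤ p := by
    have h3 : 1 ≤ 16384 * Real.log d ^ 2 := by nlinarith
    nlinarith
  have hfail := bernoulliProb_not_isUniqueOptimal hsvd (γ := 4 * Real.log d) hν hPν hQν hp1
    hνp (by linarith) hN0 (by
      have : 0 ≤ ν * Real.log d := by positivity
      nlinarith [mul_le_mul_of_nonneg_left hN this]) hNd
  have hexp : Real.exp (-(4 * Real.log d)) = (d ^ 4)⁻¹ := by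
    rw [Real.exp_neg, mul_comm, ← Real.rpow_def_of_pos (by linarith)]
    norm_cast
  -- γ = 4 log d contributes d⁻⁴, which beats d² and N ≤ 8 log d ≤ 8d with one power of d to spare.
  have hbound : 8 * N * d ^ 2 * Real.exp (-(4 * Real.log d)) ≤ 64 * d ^ (-1 : ℝ) := by
    have hld : Real.log d ≤ d := (Real.log_le_sub_one_of_pos (by linarith)).trans (by linarith)
    rw [hexp, Real.rpow_neg_one]
    calc 8 * N * d ^ 2 * (d ^ 4)⁻¹ ≤ 8 * (8 * d) * d ^ 2 * (d ^ 4)⁻¹ := by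
          gcongr; linarith
      _ = 64 * d⁻¹ := by field_simp; norm_num
  have hreal := measureReal_le_bernoulliProb hΩ (fun Ω => ¬ IsUniqueOptimal M Ω M)
  -- Subadditivity replaces complementation, so the success event need not be shown measurable.
  have hcover : (1 : ℝ) ≤ P.real {s | IsUniqueOptimal M (Ω s) M} +
      P.real {s | ¬ IsUniqueOptimal M (Ω s) M} := by
    have hu : {s | IsUniqueOptimal M (Ω s) M} ∪ {s | ¬ IsUniqueOptimal M (Ω s) M} = Set.univ := by
      ext s; simp [em]
    rw [← probReal_univ (μ := P), ← hu]
    exact measureReal_union_le _ _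
  linarith [hreal.trans (hfail.trans hbound)]
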